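/- Let $u,v>0$ and $p,q\in\mathbb R$ with $q=1-p$ and $pq>0$, and put $d=(pu+qv)^{-1}$. Consider a binary random tiling of $\mathbb R$: a bi-infinite sequence of adjacent intervals, each of which independently has length $u$ with probability $p$ and length $v$ with probability $q$. Let $\Lambda\subset\mathbb R$ be the set of left endpoints of the intervals and $\omega=\sum_{x\in\Lambda}\delta_x$. Write $\omega_R$ for the restriction of $\omega$ to $B_R=[-R,R]$ and $\tilde\omega_R$ for the image of $\omega_R$ under $x\mapsto -x$. The natural autocorrelation of $\omega$ is the vague limit $\gamma=\lim_{R\to\infty}\frac{1}{2R}\,\omega_R*\tilde\omega_R$, and the diffraction measure of $\omega$ is the Fourier transform $\hat\gamma$ of $\gamma$ as a tempered distribution (with kernel $e^{-2\pi i kx}$). Then, almost surely (simultaneously for all translates of the tiling), $\Lambda$ has natural density $d$, i.e. $\frac{1}{2R}|\Lambda\cap B_R|\to d$ as $R\to\infty$, the natural autocorrelation $\gamma$ exists, $\hat\gamma$ is a positive tempered measure, and $\hat\gamma$ has only a pure point part and an absolutely continuous part (with respect to Lebesgue measure): $$\hat\gamma=\hat\gamma_{pp}+\hat\gamma_{ac}.$$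 The pure point part is $$\hat\gamma_{pp}=d^2\,\delta_0\quad\text{if } u/v\notin\mathbb Q,\qquad \hat\gamma_{pp}=d^2\sum_{k\in\frac1\xi\mathbb Z}\delta_k\quad\text{if } u/v=a/b \text{ with coprime } a,b\in\mathbb Z,$$ where $\xi=u/a=v/b$ in the rational case. The absolutely continuous part is $\hat\gamma_{ac}=g(k)\,dk$ with a nonnegative $C^\infty$ function $g:\mathbb R\to\mathbb R$ such that $$g(k)=\frac{d\cdot pq\,\sin^2(\pi k(u-v))}{p\sin^2(\pi ku)+q\sin^2(\pi kv)-pq\sin^2(\pi k(u-v))}\qquad\text{whenever } k(u-v)\notin\mathbb Z,$$ the denominator being nonzero for these $k$. At the remaining points, $g$ has the following values. * If $u/v\notin\mathbb Q$: $g(k)=0$ for $k\neq0$ with $k(u-v)\in\mathbb Z$, and $$g(0)=\frac{d\cdot pq(u-v)^2}{pu^2+qv^2-pq(u-v)^2}=d\,\frac{pq(u-v)^2}{(pu+qv)^2}.$$ * If $u/v=a/b$ with coprime $a,b\in\mathbb Z$: for $k(u-v)\in\mathbb Z$ one has $ku\in\mathbb Z$ if and only if $kv\in\mathbb Z$; moreover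 $g(k)=0$ if $ku\notin\mathbb Z$, and $g(k)=d\,\dfrac{pq(a-b)^2}{(pa+qb)^2}$ if $ku\in\mathbb Z$. -/

import Mathlib

open MeasureTheory ProbabilityTheory Filter Topology
open scoped ENNReal FourierTransform SchwartzMap ContDiff

noncomputable section

namespace RandomTiling

/-- Length of the interval coded by a letter: `true` codes `u`, `false` codes `v`. (Letters are kept
apart from lengths, so that `u = v` is allowed.) -/
def tileLength (u v : ℝ) (b : Bool) : ℝ := if b then u else v

/-- The left endpoint of the `n`-th interval in the bi-infinite sequence of adjacent intervals with
lengths `x i`, `i ∈ ℤ`, whose interval number `0` has left endpoint `t₀`. It is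
`t₀ + x 0 + ⋯ + x (n-1)` for `n ≥ 0` and `t₀ - x (-1) - ⋯ - x n` for `n < 0`. -/
def leftEndpoint (t₀ : ℝ) (x : ℤ → ℝ) (n : ℤ) : ℝ :=
  t₀ + ∑ i ∈ Finset.Ico 0 n, x i - ∑ i ∈ Finset.Ico n 0, x i

/-- The set `Λ` of all left endpoints of the tiling by intervals of lengths `u`, `v` which is coded
by the two-sided letter sequence `b`, placed on the line by `t₀`. -/
def tilingPoints (u v t₀ : ℝ) (b : ℤ → Bool) : Set ℝ :=
  Set.range (leftEndpoint t₀ fun i => tileLength u v (b i))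

/-- The Dirac comb `∑_{x ∈ Λ} δ_x`. -/
def diracComb (Λ : Set ℝ) : Measure ℝ := Measure.sum fun x : Λ => Measure.dirac (x : ℝ)

/-- `Λ` has natural density `d`: the number of points in `B_R`, per volume, tends to `d`. -/
def HasNaturalDensity (Λ : Set ℝ) (d : ℝ) : Prop :=
  Tendsto (fun R : ℝ => ((Λ ∩ Metric.closedBall 0 R).ncard : ℝ) /
    volume.real (Metric.closedBall (0 : ℝ) R)) atTop (𝓝 d)

/-- `γ^R = vol(B_R)⁻¹ • (μ_R ∗ μ̃_R)`, where `μ_R` is the restriction of `μ` to the closed ball `B_R`;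
for a positive measure, `μ̃` is the image under `x ↦ -x`. -/
def autocorrelationApprox (μ : Measure ℝ) (R : ℝ) : Measure ℝ :=
  (volume (Metric.closedBall (0 : ℝ) R))⁻¹ •
    Measure.conv (μ.restrict (Metric.closedBall 0 R))
      ((μ.restrict (Metric.closedBall 0 R)).map fun x => -x)

/-- `γ` is the natural autocorrelation of `μ`: it is a positive Radon measure and the vague limit of
`γ^R` as `R → ∞`. -/
def IsNaturalAutocorrelation (μ γ : Measure ℝ) : Prop :=
  IsLocallyFiniteMeasure γ ∧
    ∀ f : ℝ → ℂ, Continuous f → HasCompactSupport f →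
      Tendsto (fun R : ℝ => ∫ x, f x ∂(autocorrelationApprox μ R)) atTop (𝓝 (∫ x, f x ∂γ))

/-- The positive measure `γhat` is the Fourier transform of `γ`: both are tempered measures and the
Fourier transform of the tempered distribution of `γ` is that of `γhat`
(with kernel `exp (-2πi k x)`). -/
def IsFourierTransform (γ γhat : Measure ℝ) : Prop :=
  ∃ (_ : γ.HasTemperateGrowth) (_ : γhat.HasTemperateGrowth),
    𝓕 γ.toTemperedDistribution = γhat.toTemperedDistribution

/-- Pure point part: the restriction to the set of pure points. -/
def purePointPart (μ : Measure ℝ) : Measure ℝ := μ.restrict {x | μ {x} ≠ 0}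

/-- Absolutely continuous part with respect to Lebesgue measure (Lebesgue decomposition). -/
def acPart (μ : Measure ℝ) : Measure ℝ := volume.withDensity (μ.rnDeriv volume)

/-- The real number `x` is an integer. -/
def IsInteger (x : ℝ) : Prop := ∃ n : ℤ, x = n

/-- The denominator `p sin²(πku) + q sin²(πkv) - pq sin²(πk(u-v))`. -/
def denom (u v p q k : ℝ) : ℝ :=
  p * Real.sin (Real.pi * k * u) ^ 2 + q * Real.sin (Real.pi * k * v) ^ 2
    - p * q * Real.sin (Real.pi * k * (u - v)) ^ 2

end RandomTiling

end

noncomputable section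

namespace RandomTiling

/-! The displacement between the left endpoints of tiles `j` and `j + n` is, up to sign, a sum of
`|n|` independent tile lengths. By the strong law almost every letter sequence contains each finite
word with its expected frequency (`ae_hasWordFrequencies`). Hence, wherever the origin is placed,
the autocorrelation is one deterministic measure: `d` times the sum over `n ∈ ℤ` of the displacement
laws (`isNaturalAutocorrelation_tiling`).

Let `φ(k)` be the characteristic function of one tile length. The `n`-th law has Fourier transform
`φ^n` for `n ≥ 0` and `conj(φ)^|n|` for `n < 0`. The sum of these diverges where `|φ| = 1`, so it is
Abel-regularised: with weights `r^|n|` it equals the Poisson kernel `(1 - r²|φ|²) / |1 - rφ|²`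
(`hasSum_poisson`). Split the numerator as `(1 - |φ|²) + (1 - r²)|φ|²` and let `r → 1`. The first
summand tends to `(1 - |φ|²) / |1 - φ|²`, which by trigonometry is `g / d`. The second concentrates
at the resonances `φ = 1`, that is `ku, kv ∈ ℤ`, with mass `1 / (pu + qv) = d` at each
(`tendsto_integral_poissonPP_local`). The factor `d` of the autocorrelation turns this into `d²`.
The resonances form `{0}` or `ξ⁻¹ℤ`, according to whether `u/v` is irrational or rational.

The limits need control uniform in `r`. The function `1 / (1 + k²)` has transform `π e^{-2π|x|}`,
and `n` tiles have length at least `|n| min(u, v)`, so its integrals against the Poisson kernels are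
dominated by one geometric series (`exists_integral_inv_mul_poisson_le`). Fatou's lemma then makes
the limit density integrable against this weight, and the same bound controls the tails away from
the resonances. Finally, `g` is smooth because at a resonance numerator and denominator vanish to
exactly the same second order when `u ≠ v`, and a common quadratic factor can be cancelled in all
cases (`contDiff_acDensity`). -/

/-! ### The characteristic function of a tile length and its resonances. -/

/-- The characteristic function `p e^{-2πiku} + q e^{-2πikv}` of one tile length. -/
def stepChar (u v p q k : ℝ) : ℂ :=
  p * Complex.exp ((-(2 * Real.pi * k * u) : ℝ) * Complex.I) +
    q * Complex.exp ((-(2 * Real.pi * k * v) : ℝ) * Complex.I)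

/-- The frequencies `k` for which both `ku` and `kv` are integers. -/
def resonances (u v : ℝ) : Set ℝ := {k | IsInteger (k * u) ∧ IsInteger (k * v)}

lemma stepChar_re (u v p q k : ℝ) : (stepChar u v p q k).re =
    p * Real.cos (2 * Real.pi * k * u) + q * Real.cos (2 * Real.pi * k * v) := by
  simp only [stepChar, Complex.add_re, Complex.re_ofReal_mul, Complex.exp_ofReal_mul_I_re,
    Real.cos_neg]

lemma stepChar_im (u v p q k : ℝ) : (stepChar u v p q k).im =
    -(p * Real.sin (2 * Real.pi * k * u) + q * Real.sin (2 * Real.pi * k * v)) := by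
  simp only [stepChar, Complex.add_im, Complex.im_ofReal_mul, Complex.exp_ofReal_mul_I_im,
    Real.sin_neg]
  ring

lemma continuous_stepChar (u v p q : ℝ) : Continuous (stepChar u v p q) := by
  unfold stepChar; fun_prop

lemma sin_sq_pi_mul (x : ℝ) : Real.sin (Real.pi * x) ^ 2 = (1 - Real.cos (2 * Real.pi * x)) / 2 := by
  have := Real.cos_sq (Real.pi * x)
  have h2 := Real.sin_sq_add_cos_sq (Real.pi * x)
  rw [show 2 * Real.pi * x = 2 * (Real.pi * x) by ring]
  linarith

/-- Expanding gives `|φ|² = p² + q² + 2pq cos(2πk(u - v))`, and `p² + q² + 2pq = 1`. This is the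
numerator of the density. -/
lemma one_sub_norm_stepChar_sq (u v p q k : ℝ) (hq : q = 1 - p) :
    1 - ‖stepChar u v p q k‖ ^ 2 = 4 * (p * q) * Real.sin (Real.pi * k * (u - v)) ^ 2 := by
  rw [← Complex.normSq_eq_norm_sq, Complex.normSq_apply, stepChar_re, stepChar_im, mul_assoc Real.pi,
    sin_sq_pi_mul, show 2 * Real.pi * (k * (u - v)) = 2 * Real.pi * k * u - 2 * Real.pi * k * v by ring,
    Real.cos_sub]
  have h1 := Real.sin_sq_add_cos_sq (2 * Real.pi * k * u)
  have h2 := Real.sin_sq_add_cos_sq (2 * Real.pi * k * v)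
  subst hq
  linear_combination (-(p ^ 2)) * h1 - (1 - p) ^ 2 * h2

/-- Explains the denominator of the density: it is a squared modulus, so it is nonnegative and
vanishes exactly where `φ = 1`. -/
lemma norm_one_sub_stepChar_sq (u v p q k : ℝ) (hq : q = 1 - p) :
    ‖1 - stepChar u v p q k‖ ^ 2 = 4 * denom u v p q k := by
  rw [← Complex.normSq_eq_norm_sq, Complex.normSq_apply, Complex.sub_re, Complex.sub_im, stepChar_re,
    stepChar_im, denom, mul_assoc Real.pi, mul_assoc Real.pi, mul_assoc Real.pi,
    sin_sq_pi_mul, sin_sq_pi_mul, sin_sq_pi_mul,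
    show 2 * Real.pi * (k * (u - v)) = 2 * Real.pi * k * u - 2 * Real.pi * k * v by ring,
    Real.cos_sub, ← mul_assoc, ← mul_assoc]
  have h1 := Real.sin_sq_add_cos_sq (2 * Real.pi * k * u)
  have h2 := Real.sin_sq_add_cos_sq (2 * Real.pi * k * v)
  subst hq
  simp only [Complex.one_re, Complex.one_im]
  linear_combination p ^ 2 * h1 + (1 - p) ^ 2 * h2

lemma denom_nonneg (u v p q k : ℝ) (hq : q = 1 - p) : 0 ≤ denom u v p q k := by
  have := norm_one_sub_stepChar_sq u v p q k hq
  nlinarith [sq_nonneg ‖1 - stepChar u v p q k‖]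

lemma norm_stepChar_le (u v p q k : ℝ) (hq : q = 1 - p) (hpq : 0 < p * q) :
    ‖stepChar u v p q k‖ ≤ 1 := by
  have := one_sub_norm_stepChar_sq u v p q k hq
  have h2 : 0 ≤ 4 * (p * q) * Real.sin (Real.pi * k * (u - v)) ^ 2 := by positivity
  nlinarith [norm_nonneg (stepChar u v p q k)]

lemma pos_of_mul_pos {p q : ℝ} (hq : q = 1 - p) (hpq : 0 < p * q) : 0 < p ∧ 0 < q := by
  rcases pos_and_pos_or_neg_and_neg_of_mul_pos hpq with h | h
  · exact h
  · exfalso; linarith [h.1, h.2]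

lemma cos_eq_one_iff_isInteger (x : ℝ) : Real.cos (2 * Real.pi * x) = 1 ↔ IsInteger x := by
  rw [Real.cos_eq_one_iff]
  constructor
  · rintro ⟨n, hn⟩
    refine ⟨n, ?_⟩
    have := Real.pi_pos
    have h : 2 * Real.pi * (x - n) = 0 := by linarith
    rcases mul_eq_zero.1 h with h | h <;> linarith
  · rintro ⟨n, rfl⟩
    exact ⟨n, by ring⟩

lemma IsInteger.sub {x y : ℝ} (hx : IsInteger x) (hy : IsInteger y) : IsInteger (x - y) := by
  obtain ⟨m, rfl⟩ := hx
  obtain ⟨n, rfl⟩ := hy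
  exact ⟨m - n, by push_cast; rfl⟩

lemma IsInteger.add {x y : ℝ} (hx : IsInteger x) (hy : IsInteger y) : IsInteger (x + y) := by
  obtain ⟨m, rfl⟩ := hx
  obtain ⟨n, rfl⟩ := hy
  exact ⟨m + n, by push_cast; rfl⟩

lemma resonances_sub {u v x y : ℝ} (hx : x ∈ resonances u v) (hy : y ∈ resonances u v) :
    x - y ∈ resonances u v := by
  refine ⟨?_, ?_⟩ <;> rw [sub_mul]
  exacts [hx.1.sub hy.1, hx.2.sub hy.2]

lemma zero_mem_resonances (u v : ℝ) : (0 : ℝ) ∈ resonances u v :=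
  ⟨⟨0, by simp⟩, ⟨0, by simp⟩⟩

/-- A convex combination with positive weights of two points of the unit circle equals `1` only if
both points do; real parts already suffice to see this. -/
lemma stepChar_eq_one_iff (u v p q k : ℝ) (hq : q = 1 - p) (hpq : 0 < p * q) :
    stepChar u v p q k = 1 ↔ k ∈ resonances u v := by
  obtain ⟨hp0, hq0⟩ := pos_of_mul_pos hq hpq
  constructor
  · intro h
    have h1 := congrArg Complex.re h
    rw [stepChar_re, Complex.one_re] at h1
    have c1 := Real.cos_le_one (2 * Real.pi * k * u)
    have c2 := Real.cos_le_one (2 * Real.pi * k * v)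
    have e1 : Real.cos (2 * Real.pi * k * u) = 1 := by nlinarith
    have e2 : Real.cos (2 * Real.pi * k * v) = 1 := by nlinarith
    rw [mul_assoc, cos_eq_one_iff_isInteger] at e1 e2
    exact ⟨e1, e2⟩
  · rintro ⟨h1, h2⟩
    rw [← cos_eq_one_iff_isInteger, ← mul_assoc] at h1 h2
    have s1 : Real.sin (2 * Real.pi * k * u) = 0 := Real.sin_eq_zero_iff_cos_eq.2 (Or.inl h1)
    have s2 : Real.sin (2 * Real.pi * k * v) = 0 := Real.sin_eq_zero_iff_cos_eq.2 (Or.inl h2)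
    apply Complex.ext
    · rw [stepChar_re, h1, h2, hq]; simp
    · rw [stepChar_im, s1, s2]; simp

lemma denom_eq_zero_iff (u v p q k : ℝ) (hq : q = 1 - p) (hpq : 0 < p * q) :
    denom u v p q k = 0 ↔ k ∈ resonances u v := by
  have h := norm_one_sub_stepChar_sq u v p q k hq
  rw [← stepChar_eq_one_iff u v p q k hq hpq, eq_comm (b := (1 : ℂ)),
    ← sub_eq_zero (a := (1 : ℂ)), ← norm_eq_zero (a := 1 - stepChar u v p q k),
    ← sq_eq_zero_iff (a := ‖1 - stepChar u v p q k‖), h]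
  simp

lemma exp_add_of_isInteger {z u : ℝ} (hz : IsInteger (z * u)) (t : ℝ) :
    Complex.exp ((-(2 * Real.pi * (z + t) * u) : ℝ) * Complex.I) =
      Complex.exp ((-(2 * Real.pi * t * u) : ℝ) * Complex.I) := by
  obtain ⟨n, hn⟩ := hz
  rw [Complex.exp_eq_exp_iff_exists_int]
  refine ⟨-n, ?_⟩
  have : (-(2 * Real.pi * (z + t) * u) : ℝ) = -(2 * Real.pi * t * u) - 2 * Real.pi * n := by
    rw [← hn]; ring
  rw [this]; push_cast; ring

lemma stepChar_add {u v z : ℝ} (hz : z ∈ resonances u v) (p q t : ℝ) :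
    stepChar u v p q (z + t) = stepChar u v p q t := by
  unfold stepChar
  rw [exp_add_of_isInteger hz.1, exp_add_of_isInteger hz.2]

lemma stepChar_zero (u v p q : ℝ) (hq : q = 1 - p) : stepChar u v p q 0 = 1 := by
  simp [stepChar, hq]

/-- The slope is `-2πi` times the mean tile length; it determines the mass of the peaks in the limit
`r → 1`. -/
lemma hasDerivAt_stepChar_zero (u v p q : ℝ) : HasDerivAt (stepChar u v p q)
    (-(2 * Real.pi * (p * u + q * v) : ℝ) * Complex.I) 0 := by
  have key : ∀ x : ℝ, HasDerivAt (fun k : ℝ => Complex.exp ((-(2 * Real.pi * k * x) : ℝ) * Complex.I))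
      (-(2 * Real.pi * x : ℝ) * Complex.I) 0 := by
    intro x
    have h1 : HasDerivAt (fun k : ℝ => -(2 * Real.pi * k * x)) (-(2 * Real.pi * x)) 0 := by
      have := ((hasDerivAt_id (0 : ℝ)).const_mul (-(2 * Real.pi * x)))
      rw [mul_one] at this
      exact this.congr_of_eventuallyEq (Eventually.of_forall fun k => by simp only [id]; ring)
    have h2 := (h1.ofReal_comp.mul_const Complex.I).cexp
    simpa using h2
  exact (((key u).const_mul (p : ℂ)).add ((key v).const_mul (q : ℂ))).congr_deriv
    (by push_cast; ring)

/-- A nonzero integer `zu` has modulus at least `1`. Since the resonances are closed under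
subtraction, they are `1/u`-separated. -/
lemma abs_ge_of_mem_resonances {u v z : ℝ} (hu : 0 < u) (hz : z ∈ resonances u v) (h0 : z ≠ 0) :
    1 / u ≤ |z| := by
  obtain ⟨⟨n, hn⟩, -⟩ := hz
  have hn0 : n ≠ 0 := by
    rintro rfl
    simp [hu.ne', h0] at hn
  have h1 : (1 : ℝ) ≤ |(n : ℝ)| := by exact_mod_cast Int.one_le_abs hn0
  rw [← hn, abs_mul, abs_of_pos hu] at h1
  rwa [div_le_iff₀ hu]

lemma isClosed_resonances (u v p q : ℝ) (hq : q = 1 - p) (hpq : 0 < p * q) :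
    IsClosed (resonances u v) := by
  have : resonances u v = stepChar u v p q ⁻¹' {1} := by
    ext k; simp [← stepChar_eq_one_iff u v p q k hq hpq]
  rw [this]
  exact isClosed_singleton.preimage (continuous_stepChar u v p q)

/-! ### The density `g` and its smoothness. -/

open Classical in
/-- The density of the absolutely continuous part of the diffraction. -/
def acDensity (u v p q d k : ℝ) : ℝ :=
  if k ∈ resonances u v then d * (p * q) * (u - v) ^ 2 / (p * u + q * v) ^ 2
  else d * (p * q) * Real.sin (Real.pi * k * (u - v)) ^ 2 / denom u v p q k

lemma sin_eq_mul_sinc (x : ℝ) : Real.sin x = x * Real.sinc x := by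
  by_cases h : x = 0
  · simp [h]
  · rw [Real.sinc_of_ne_zero h]; field_simp

/-- `sinc` is the difference quotient of the analytic function `sin` at `0`, hence analytic there.
-/
lemma contDiffAt_sinc_zero : ContDiffAt ℝ ∞ Real.sinc 0 := by
  rw [Real.sinc_eq_dslope]
  obtain ⟨s, hs⟩ := (Real.analyticAt_sin (x := 0))
  exact (hs.has_fpower_series_dslope_fslope).analyticAt.contDiffAt

lemma contDiffAt_sinc_mul_zero (c : ℝ) : ContDiffAt ℝ ∞ (fun t => Real.sinc (c * t)) 0 := by
  refine ContDiffAt.comp (g := Real.sinc) (f := fun t => c * t) 0 ?_ (by fun_prop)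
  simpa using contDiffAt_sinc_zero

lemma sin_sq_add_of_isInteger {z c : ℝ} (hz : IsInteger (z * c)) (t : ℝ) :
    Real.sin (Real.pi * (z + t) * c) ^ 2 = Real.sin (Real.pi * t * c) ^ 2 := by
  obtain ⟨n, hn⟩ := hz
  rw [mul_assoc, mul_assoc, sin_sq_pi_mul, sin_sq_pi_mul, add_mul, hn,
    show 2 * Real.pi * (n + t * c) = 2 * Real.pi * (t * c) + n * (2 * Real.pi) by ring,
    Real.cos_add_int_mul_two_pi]

/-- Off the resonances this is a quotient with nonzero denominator. At a resonance `k` all the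
squared sines are unchanged by translation by `k`, so `k` may be moved to `0`, where `sin x = x sinc
x` exposes the common factor `(πt)²`. -/
lemma contDiff_acDensity (u v p q d : ℝ) (hu : 0 < u) (hv : 0 < v) (hq : q = 1 - p)
    (hpq : 0 < p * q) : ContDiff ℝ ∞ (acDensity u v p q d) := by
  obtain ⟨hp0, hq0⟩ := pos_of_mul_pos hq hpq
  rw [contDiff_iff_contDiffAt]
  intro k
  by_cases hk : k ∈ resonances u v
  -- The quotient after cancelling `(πt)²`; its denominator at `t = 0` is `(pu + qv)²`, by `hm`.
  · set N : ℝ → ℝ := fun t => d * (p * q) * (u - v) ^ 2 * Real.sinc ((Real.pi * (u - v)) * t) ^ 2 /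
      (p * u ^ 2 * Real.sinc ((Real.pi * u) * t) ^ 2 + q * v ^ 2 * Real.sinc ((Real.pi * v) * t) ^ 2
        - p * q * (u - v) ^ 2 * Real.sinc ((Real.pi * (u - v)) * t) ^ 2) with hN
    have hm : p * u ^ 2 + q * v ^ 2 - p * q * (u - v) ^ 2 = (p * u + q * v) ^ 2 := by
      rw [hq]; ring
    have hmpos : 0 < p * u + q * v := by positivity
    have hNs : ContDiffAt ℝ ∞ N 0 := by
      have a1 := contDiffAt_sinc_mul_zero (Real.pi * (u - v))
      have a2 := contDiffAt_sinc_mul_zero (Real.pi * u)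
      have a3 := contDiffAt_sinc_mul_zero (Real.pi * v)
      refine ContDiffAt.div (contDiffAt_const.mul (a1.pow 2)) (((contDiffAt_const.mul (a2.pow 2)).add
        (contDiffAt_const.mul (a3.pow 2))).sub (contDiffAt_const.mul (a1.pow 2))) ?_
      simp only [mul_zero, Real.sinc_zero, one_pow, mul_one, hm]
      positivity
    have hcomp : ContDiffAt ℝ ∞ (fun x => N (x - k)) k := by
      refine ContDiffAt.comp (g := N) (f := fun x => x - k) k ?_ (by fun_prop)
      simpa using hNs
    refine hcomp.congr_of_eventuallyEq ?_
    -- A ball of radius `1/u` contains no second resonance, so the trigonometric formula applies on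
    -- it away from `k`.
    have hball : Metric.ball k (1 / u) ∈ 𝓝 k := Metric.ball_mem_nhds _ (by positivity)
    filter_upwards [hball] with x hx
    by_cases hxk : x = k
    · subst hxk
      simp only [acDensity, hk, if_true, hN, sub_self, mul_zero, Real.sinc_zero, one_pow, mul_one, hm]
    · have hxr : x ∉ resonances u v := by
        intro h
        have := abs_ge_of_mem_resonances hu (resonances_sub h hk) (sub_ne_zero.2 hxk)
        rw [Metric.mem_ball, Real.dist_eq] at hx
        linarith
      have ht : x - k ≠ 0 := sub_ne_zero.2 hxk
      have hxe : x = k + (x - k) := by ring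
      simp only [acDensity, hxr, if_false, hN, denom]
      set t := x - k with htdef
      have huv : IsInteger (k * (u - v)) := by rw [mul_sub]; exact hk.1.sub hk.2
      rw [hxe, sin_sq_add_of_isInteger hk.1, sin_sq_add_of_isInteger hk.2,
        sin_sq_add_of_isInteger huv, sin_eq_mul_sinc (Real.pi * t * u),
        sin_eq_mul_sinc (Real.pi * t * v), sin_eq_mul_sinc (Real.pi * t * (u - v)),
        mul_right_comm Real.pi t u, mul_right_comm Real.pi t v, mul_right_comm Real.pi t (u - v)]
      have hpt : (Real.pi * t) ^ 2 ≠ 0 := pow_ne_zero 2 (mul_ne_zero Real.pi_ne_zero ht)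
      rw [← mul_div_mul_left (d * (p * q) * (u - v) ^ 2 * Real.sinc (Real.pi * (u - v) * t) ^ 2) _ hpt]
      congr 1 <;> ring
  · have hd : denom u v p q k ≠ 0 := fun h => hk ((denom_eq_zero_iff u v p q k hq hpq).1 h)
    have hq' : ContDiffAt ℝ ∞ (fun k => d * (p * q) * Real.sin (Real.pi * k * (u - v)) ^ 2 /
        denom u v p q k) k := by
      refine ContDiffAt.div (by fun_prop) ?_ hd
      unfold denom; fun_prop
    refine hq'.congr_of_eventuallyEq ?_
    filter_upwards [(isClosed_resonances u v p q hq hpq).isOpen_compl.mem_nhds hk] with x hx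
    simp only [acDensity, if_neg hx]

lemma acDensity_nonneg (u v p q d k : ℝ) (hd : 0 ≤ d) (hq : q = 1 - p) (hpq : 0 < p * q) :
    0 ≤ acDensity u v p q d k := by
  unfold acDensity
  have := denom_nonneg u v p q k hq
  split_ifs <;> positivity

lemma sin_eq_zero_of_isInteger {x : ℝ} (h : IsInteger x) : Real.sin (Real.pi * x) = 0 := by
  obtain ⟨n, rfl⟩ := h
  rw [mul_comm, Real.sin_int_mul_pi]

lemma acDensity_eq_zero {u v k : ℝ} (p q d : ℝ) (hk : k ∉ resonances u v)
    (h : IsInteger (k * (u - v))) : acDensity u v p q d k = 0 := by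
  simp [acDensity, hk, mul_assoc Real.pi, sin_eq_zero_of_isInteger h]

/-! ### The resonances for irrational and for rational `u/v`. -/

lemma resonances_eq_of_irrational {u v : ℝ} (h : Irrational (u / v)) : resonances u v = {0} := by
  ext k
  constructor
  · rintro ⟨⟨m, hm⟩, ⟨n, hn⟩⟩
    by_contra hk
    have hk : k ≠ 0 := hk
    apply h
    refine ⟨(m : ℚ) / n, ?_⟩
    push_cast
    rw [← hm, ← hn, mul_div_mul_left _ _ hk]
  · rintro rfl
    exact zero_mem_resonances u v

lemma resonances_eq_of_rational {u v : ℝ} (hu : 0 < u) (hv : 0 < v) {a b : ℤ} (hab : IsCoprime a b)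
    (h : u / v = a / b) : u / a = v / b ∧
      resonances u v = Set.range fun m : ℤ => 1 / (u / a) * (m : ℝ) := by
  have hpos : 0 < u / v := by positivity
  -- A zero `b` would give `u/v = 0` by the convention for division, against positivity.
  have hb : (b : ℝ) ≠ 0 := by
    intro hb; rw [h, hb] at hpos; simp at hpos
  have ha : (a : ℝ) ≠ 0 := by
    intro hb; rw [h, hb] at hpos; simp at hpos
  have hξ : u / a = v / b := by
    field_simp at h ⊢; linarith
  refine ⟨hξ, ?_⟩
  set ξ := u / a with hξd
  have hξ0 : ξ ≠ 0 := div_ne_zero hu.ne' ha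
  have hua : u = ξ * a := by rw [hξd]; field_simp
  have hvb : v = ξ * b := by rw [hξ]; field_simp
  ext k
  constructor
  · rintro ⟨⟨m, hm⟩, ⟨n, hn⟩⟩
    obtain ⟨s, t, hst⟩ := hab
    have hst' : (s : ℝ) * a + t * b = 1 := by exact_mod_cast hst
    -- Bézout: `s(ku) + t(kv) = kξ(sa + tb) = kξ`, so `kξ` is an integer.
    refine ⟨s * m + t * n, ?_⟩
    push_cast
    rw [← hm, ← hn, hua, hvb]
    field_simp
    linear_combination k * hst'
  · rintro ⟨m, rfl⟩
    refine ⟨⟨m * a, ?_⟩, ⟨m * b, ?_⟩⟩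
    · rw [hua]; push_cast; field_simp
    · rw [hvb]; push_cast; field_simp

/-! ### The Poisson kernel, its two summands and the peak at the origin. -/

/-- The Poisson kernel `(1 - r²|φ|²) / |1 - rφ|²` evaluated along `φ = stepChar`. -/
def poisson (u v p q r k : ℝ) : ℝ :=
  (1 - r ^ 2 * ‖stepChar u v p q k‖ ^ 2) / ‖1 - r * stepChar u v p q k‖ ^ 2

/-- The summand of the Poisson kernel which converges to a function. -/
def poissonAC (u v p q r k : ℝ) : ℝ :=
  (1 - ‖stepChar u v p q k‖ ^ 2) / ‖1 - r * stepChar u v p q k‖ ^ 2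

/-- The summand of the Poisson kernel which converges to point masses. -/
def poissonPP (u v p q r k : ℝ) : ℝ :=
  (1 - r ^ 2) * ‖stepChar u v p q k‖ ^ 2 / ‖1 - r * stepChar u v p q k‖ ^ 2

lemma poisson_eq_add (u v p q r k : ℝ) :
    poisson u v p q r k = poissonAC u v p q r k + poissonPP u v p q r k := by
  rw [poisson, poissonAC, poissonPP, ← add_div]
  congr 1; ring

lemma one_sub_le_norm {z : ℂ} (hz : ‖z‖ ≤ 1) {r : ℝ} (h0 : 0 ≤ r) : 1 - r ≤ ‖1 - r * z‖ := by
  have h1 := norm_sub_norm_le (1 : ℂ) (r * z)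
  rw [norm_one, norm_mul, Complex.norm_real, Real.norm_of_nonneg h0] at h1
  nlinarith

/-- Write `1 - z = (1 - rz) - (1 - r)z` and use `1 - r ≤ |1 - rz|`. It replaces denominators
depending on `r` by ones that do not. -/
lemma norm_one_sub_le {z : ℂ} (hz : ‖z‖ ≤ 1) {r : ℝ} (h0 : 0 ≤ r) (h1 : r ≤ 1) :
    ‖1 - z‖ ≤ 2 * ‖1 - r * z‖ := by
  have h := one_sub_le_norm hz h0
  have e : 1 - z = (1 - r * z) - ((1 - r : ℝ) : ℂ) * z := by push_cast; ring
  have h2 := norm_sub_le (1 - r * z) (((1 - r : ℝ) : ℂ) * z)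
  rw [← e, norm_mul, Complex.norm_real, Real.norm_of_nonneg (by linarith)] at h2
  nlinarith [norm_nonneg z]

section
variable {u v p q : ℝ} (hu : 0 < u) (hv : 0 < v) (hq : q = 1 - p) (hpq : 0 < p * q)

include hq hpq

lemma norm_one_sub_mul_stepChar_pos {r : ℝ} (h0 : 0 ≤ r) (h1 : r < 1) (k : ℝ) :
    0 < ‖1 - r * stepChar u v p q k‖ :=
  lt_of_lt_of_le (by linarith) (one_sub_le_norm (norm_stepChar_le u v p q k hq hpq) h0)

lemma norm_stepChar_sq_le (k : ℝ) : ‖stepChar u v p q k‖ ^ 2 ≤ 1 :=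
  pow_le_one₀ (norm_nonneg _) (norm_stepChar_le u v p q k hq hpq)

lemma poissonAC_nonneg (r k : ℝ) : 0 ≤ poissonAC u v p q r k :=
  div_nonneg (by linarith [norm_stepChar_sq_le (u := u) (v := v) hq hpq k]) (by positivity)

omit hq hpq in
lemma poissonPP_nonneg {r : ℝ} (h0 : 0 ≤ r) (h1 : r < 1) (k : ℝ) : 0 ≤ poissonPP u v p q r k :=
  div_nonneg (mul_nonneg (by nlinarith) (by positivity)) (by positivity)

lemma continuous_poissonAC {r : ℝ} (h0 : 0 ≤ r) (h1 : r < 1) :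
    Continuous (poissonAC u v p q r) := by
  have := continuous_stepChar u v p q
  refine Continuous.div (by fun_prop) (by fun_prop) fun k => ?_
  exact (pow_pos (norm_one_sub_mul_stepChar_pos hq hpq h0 h1 k) 2).ne'

lemma continuous_poissonPP {r : ℝ} (h0 : 0 ≤ r) (h1 : r < 1) :
    Continuous (poissonPP u v p q r) := by
  have := continuous_stepChar u v p q
  refine Continuous.div (by fun_prop) (by fun_prop) fun k => ?_
  exact (pow_pos (norm_one_sub_mul_stepChar_pos hq hpq h0 h1 k) 2).ne'

lemma poissonAC_le {r : ℝ} (h0 : 0 ≤ r) (h1 : r < 1) (k : ℝ) :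
    poissonAC u v p q r k ≤ 1 / (1 - r) ^ 2 := by
  have h2 := one_sub_le_norm (norm_stepChar_le u v p q k hq hpq) h0
  have h3 : 0 < 1 - r := by linarith
  unfold poissonAC
  gcongr
  linarith [sq_nonneg ‖stepChar u v p q k‖]

/-- Off a neighbourhood of the resonances the second summand is small. -/
lemma poissonPP_le {r : ℝ} (h0 : 0 ≤ r) (h1 : r < 1) {k c : ℝ} (hc : 0 < c)
    (hk : c ≤ ‖1 - stepChar u v p q k‖) : poissonPP u v p q r k ≤ (1 - r ^ 2) * (4 / c ^ 2) := by
  have h2 := norm_one_sub_le (norm_stepChar_le u v p q k hq hpq) h0 h1.le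
  have h3 := norm_stepChar_sq_le (u := u) (v := v) hq hpq k
  have h4 : c / 2 ≤ ‖1 - r * stepChar u v p q k‖ := by linarith
  have h5 : 0 ≤ 1 - r ^ 2 := by nlinarith
  unfold poissonPP
  calc _ ≤ (1 - r ^ 2) * 1 / (c / 2) ^ 2 := by gcongr
    _ = _ := by field_simp; norm_num

lemma poissonPP_le_inv {r : ℝ} (h0 : 0 ≤ r) (h1 : r < 1) (k : ℝ) :
    poissonPP u v p q r k ≤ 1 / (1 - r) ^ 2 := by
  have h2 := one_sub_le_norm (norm_stepChar_le u v p q k hq hpq) h0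
  have h3 := norm_stepChar_sq_le (u := u) (v := v) hq hpq k
  have h4 : 0 < 1 - r := by linarith
  unfold poissonPP
  gcongr
  nlinarith [sq_nonneg r, sq_nonneg ‖stepChar u v p q k‖]

lemma poisson_nonneg {r : ℝ} (h0 : 0 ≤ r) (h1 : r < 1) (k : ℝ) : 0 ≤ poisson u v p q r k := by
  rw [poisson_eq_add]
  exact add_nonneg (poissonAC_nonneg hq hpq r k) (poissonPP_nonneg h0 h1 k)

include hu hv in
-- The difference quotient of `φ` at `0` is continuous and nowhere zero on this compact interval: at
-- `0` it is the derivative, and elsewhere a zero would be a resonance closer to `0` than `1/u`.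
lemma exists_mul_abs_le_norm_one_sub : ∃ c : ℝ, 0 < c ∧
    ∀ t ∈ Set.Icc (-(1 / (4 * u))) (1 / (4 * u)), c * |t| ≤ ‖1 - stepChar u v p q t‖ := by
  obtain ⟨hp0, hq0⟩ := pos_of_mul_pos hq hpq
  have hD := hasDerivAt_stepChar_zero u v p q
  have hcont : ContinuousOn (fun t => ‖dslope (stepChar u v p q) 0 t‖)
      (Set.Icc (-(1 / (4 * u))) (1 / (4 * u))) := by
    have : Continuous (dslope (stepChar u v p q) 0) := by
      rw [← continuousOn_univ, continuousOn_dslope Filter.univ_mem]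
      exact ⟨(continuous_stepChar u v p q).continuousOn, hD.differentiableAt⟩
    exact this.norm.continuousOn
  have hid : ∀ t : ℝ, ‖1 - stepChar u v p q t‖ = ‖dslope (stepChar u v p q) 0 t‖ * |t| := by
    intro t
    have := sub_smul_dslope (stepChar u v p q) 0 t
    rw [stepChar_zero u v p q hq, sub_zero] at this
    rw [norm_sub_rev, ← this, norm_smul, Real.norm_eq_abs, mul_comm]
  obtain ⟨c, hc, h⟩ := isCompact_Icc.exists_forall_le' hcont (a := 0) (by
    intro t ht
    by_cases h0 : t = 0
    · rw [h0, dslope_same, hD.deriv, norm_mul, Complex.norm_I, mul_one, norm_neg, Complex.norm_real,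
        norm_pos_iff]
      have := Real.pi_pos
      positivity
    · by_contra hn
      have hz : ‖dslope (stepChar u v p q) 0 t‖ = 0 := le_antisymm (not_lt.1 hn) (norm_nonneg _)
      have h1 := hid t
      rw [hz, zero_mul, norm_eq_zero, sub_eq_zero, eq_comm,
        stepChar_eq_one_iff u v p q t hq hpq] at h1
      have h2 := abs_ge_of_mem_resonances hu h1 h0
      have h3 := abs_le.2 ht
      have h4 : 1 / (4 * u) < 1 / u := by
        apply one_div_lt_one_div_of_lt hu; linarith
      linarith)
  refine ⟨c, hc, fun t ht => ?_⟩
  rw [hid]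
  exact mul_le_mul_of_nonneg_right (h t ht) (abs_nonneg t)

include hu hv in
/-- The rescaled kernel has a dominating function independent of the scale. -/
lemma exists_peak_bound : ∃ c : ℝ, 0 < c ∧ ∀ r : ℝ, 0 < r → r < 1 → ∀ s : ℝ,
    (1 - r) * s ∈ Set.Icc (-(1 / (4 * u))) (1 / (4 * u)) →
    (1 - r) * poissonPP u v p q r ((1 - r) * s) ≤ 4 * (1 + (c * s) ^ 2)⁻¹ := by
  obtain ⟨c, hc, h⟩ := exists_mul_abs_le_norm_one_sub (v := v) hu hv hq hpq
  refine ⟨c / 2, by positivity, fun r h0 h1 s hs => ?_⟩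
  have hε : 0 < 1 - r := by linarith
  set φ := stepChar u v p q ((1 - r) * s) with hφ
  have hz := norm_stepChar_le u v p q ((1 - r) * s) hq hpq
  rw [← hφ] at hz
  have a1 := one_sub_le_norm hz h0.le
  have a2 := norm_one_sub_le hz h0.le h1.le
  have a3 := h _ hs
  rw [abs_mul, abs_of_pos hε, ← hφ] at a3
  have a4 : (1 - r) * (c / 2 * |s|) ≤ ‖1 - r * φ‖ := by linarith
  -- The mean of two lower bounds for the same square: `1 - r` governs the centre of the peak, `(1 -
  -- r)(c/2)|s|` its flanks.
  have a5 : (1 - r) ^ 2 * (1 + (c / 2 * s) ^ 2) / 2 ≤ ‖1 - r * φ‖ ^ 2 := by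
    have b1 : (1 - r) ^ 2 ≤ ‖1 - r * φ‖ ^ 2 := by gcongr
    have b2 : ((1 - r) * (c / 2 * |s|)) ^ 2 ≤ ‖1 - r * φ‖ ^ 2 := by gcongr
    have b3 : ((1 - r) * (c / 2 * |s|)) ^ 2 = (1 - r) ^ 2 * (c / 2 * s) ^ 2 := by
      rw [mul_pow, mul_pow (c / 2), sq_abs]; ring
    linarith
  have a6 : ‖φ‖ ^ 2 ≤ 1 := pow_le_one₀ (norm_nonneg _) hz
  unfold poissonPP
  rw [← hφ]
  have a7 : (1 - r) * ((1 - r ^ 2) * ‖φ‖ ^ 2) ≤ 2 * (1 - r) ^ 2 := by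
    have : (1 - r ^ 2) ≤ 2 * (1 - r) := by nlinarith
    have h0' : 0 ≤ 1 - r ^ 2 := by nlinarith
    nlinarith [mul_le_mul_of_nonneg_left a6 h0', sq_nonneg ‖φ‖]
  rw [← mul_div_assoc]
  calc _ ≤ 2 * (1 - r) ^ 2 / ((1 - r) ^ 2 * (1 + (c / 2 * s) ^ 2) / 2) := by gcongr
    _ = _ := by field_simp; norm_num

include hu hv in
/-- The mass of the second summand of the Poisson kernel near `0` is uniformly bounded. -/
lemma exists_integral_poissonPP_le : ∃ C : ℝ, ∀ r : ℝ, 0 < r → r < 1 →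
    ∫ t in Set.Icc (-(1 / (4 * u))) (1 / (4 * u)), poissonPP u v p q r t ≤ C := by
  obtain ⟨c, hc, h⟩ := exists_peak_bound (v := v) hu hv hq hpq
  refine ⟨∫ s : ℝ, 4 * (1 + (c * s) ^ 2)⁻¹, fun r h0 h1 => ?_⟩
  have hε : 0 < 1 - r := by linarith
  set S := Set.Icc (-(1 / (4 * u))) (1 / (4 * u)) with hS
  -- The substitution `t = (1 - r)s` magnifies the peak to unit scale.
  have e := Measure.integral_comp_mul_left (S.indicator (poissonPP u v p q r)) (1 - r)
  rw [integral_indicator measurableSet_Icc, abs_of_pos (by positivity), smul_eq_mul] at e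
  have e2 : ∫ t in S, poissonPP u v p q r t =
      ∫ s : ℝ, (1 - r) * S.indicator (poissonPP u v p q r) ((1 - r) * s) := by
    rw [integral_const_mul, e, mul_inv_cancel_left₀ hε.ne']
  rw [e2]
  refine integral_mono_of_nonneg (Eventually.of_forall fun s => ?_)
    ((integrable_inv_one_add_sq.comp_mul_left' hc.ne').const_mul 4)
    (Eventually.of_forall fun s => ?_)
  · exact mul_nonneg hε.le (Set.indicator_nonneg (fun x _ => poissonPP_nonneg h0.le h1 x) _)
  · by_cases hs : (1 - r) * s ∈ S
    · simp only [Set.indicator_of_mem hs]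
      exact h r h0 h1 s hs
    · simp only [Set.indicator_of_notMem hs, mul_zero]
      positivity

include hu hv in
/-- Near `0`, the second summand of the Poisson kernel converges to a point mass. -/
lemma tendsto_integral_poissonPP_local {F : ℝ → ℂ} (hF : Continuous F) {r : ℕ → ℝ}
    (h0 : ∀ n, 0 < r n) (h1 : ∀ n, r n < 1) (hr : Tendsto r atTop (𝓝 1)) :
    Tendsto (fun n => ∫ t in Set.Icc (-(1 / (4 * u))) (1 / (4 * u)),
      poissonPP u v p q (r n) t • F t) atTop (𝓝 ((1 / (p * u + q * v) : ℝ) • F 0)) := by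
  obtain ⟨hp0, hq0⟩ := pos_of_mul_pos hq hpq
  obtain ⟨c, hc, h⟩ := exists_peak_bound (v := v) hu hv hq hpq
  set m := p * u + q * v with hm
  have hmpos : 0 < m := by positivity
  set S := Set.Icc (-(1 / (4 * u))) (1 / (4 * u)) with hS
  obtain ⟨M, hM⟩ := isCompact_Icc.exists_bound_of_continuousOn (s := S) hF.continuousOn
  have hε : ∀ n, 0 < 1 - r n := fun n => by linarith [h1 n]
  have hε0 : Tendsto (fun n => 1 - r n) atTop (𝓝 0) := by
    simpa using hr.const_sub 1
  have e2 : ∀ n, ∫ t in S, poissonPP u v p q (r n) t • F t =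
      ∫ s : ℝ, (1 - r n) • S.indicator (fun t => poissonPP u v p q (r n) t • F t)
        ((1 - r n) * s) := by
    intro n
    have e := Measure.integral_comp_mul_left
      (S.indicator (fun t => poissonPP u v p q (r n) t • F t)) (1 - r n)
    rw [integral_indicator measurableSet_Icc, abs_of_pos (inv_pos.2 (hε n))] at e
    rw [integral_smul, e, smul_inv_smul₀ (hε n).ne']
  -- The rescaled peak tends to the profile `2 / (1 + (2πms)²)`, whose integral over the line is
  -- `1/m`.
  have hlim : (1 / m : ℝ) • F 0 = ∫ s : ℝ, (2 * (1 + ((2 * Real.pi * m) * s) ^ 2)⁻¹ : ℝ) • F 0 := by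
    rw [integral_smul_const, integral_const_mul,
      Measure.integral_comp_mul_left (fun s => (1 + s ^ 2)⁻¹) (2 * Real.pi * m),
      integral_univ_inv_one_add_sq, abs_of_pos (by positivity), smul_eq_mul]
    congr 1
    field_simp
  simp_rw [e2]
  rw [hlim]
  refine tendsto_integral_of_dominated_convergence (fun s => 4 * (1 + (c * s) ^ 2)⁻¹ * M) ?_ ?_ ?_ ?_
  · intro n
    have hc := continuous_poissonPP (u := u) (v := v) hq hpq (h0 n).le (h1 n)
    have : Measurable (S.indicator (fun t => poissonPP u v p q (r n) t • F t)) :=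
      (hc.smul hF).measurable.indicator measurableSet_Icc
    exact ((this.comp (measurable_const_mul (1 - r n))).const_smul (1 - r n)).aestronglyMeasurable
  · exact ((integrable_inv_one_add_sq.comp_mul_left' hc.ne').const_mul 4).mul_const M
  · intro n
    refine Eventually.of_forall fun s => ?_
    by_cases hs : (1 - r n) * s ∈ S
    · rw [Set.indicator_of_mem hs, norm_smul, norm_smul, ← mul_assoc, Real.norm_of_nonneg (hε n).le,
        Real.norm_of_nonneg (poissonPP_nonneg (h0 n).le (h1 n) _)]
      have := h (r n) (h0 n) (h1 n) s hs
      have h3 := hM _ hs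
      gcongr
    · rw [Set.indicator_of_notMem hs, smul_zero, norm_zero]
      have : 0 ≤ M := (norm_nonneg _).trans (hM 0 ⟨by simp; positivity, by positivity⟩)
      positivity
  · refine Eventually.of_forall fun s => ?_
    have hεs : Tendsto (fun n => (1 - r n) * s) atTop (𝓝 0) := by simpa using hε0.mul_const s
    have hmem : ∀ᶠ n in atTop, (1 - r n) * s ∈ S :=
      hεs.eventually (Icc_mem_nhds (by simp; positivity) (by positivity))
    have hD := hasDerivAt_stepChar_zero u v p q
    have hφ : Tendsto (fun n => stepChar u v p q ((1 - r n) * s)) atTop (𝓝 1) := by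
      have := ((continuous_stepChar u v p q).tendsto 0).comp hεs
      rwa [stepChar_zero u v p q hq] at this
    have hds : Tendsto (fun n => dslope (stepChar u v p q) 0 ((1 - r n) * s)) atTop
        (𝓝 (-(2 * Real.pi * m : ℝ) * Complex.I)) := by
      have := (continuousAt_dslope_same.2 hD.differentiableAt).tendsto.comp hεs
      rwa [dslope_same, hD.deriv] at this
    have hnorm : Tendsto (fun n => ‖stepChar u v p q ((1 - r n) * s)
        - s * dslope (stepChar u v p q) 0 ((1 - r n) * s)‖ ^ 2) atTop
        (𝓝 (1 + ((2 * Real.pi * m) * s) ^ 2)) := by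
      have := ((hφ.sub (hds.const_mul (s : ℂ))).norm).pow 2
      convert this using 2
      rw [← Complex.normSq_eq_norm_sq, Complex.normSq_apply]
      simp
      ring
    -- With `D` the difference quotient of `φ` at `0`, taken at `(1 - r)s`, one has exactly `1 - rφ
    -- = (1 - r)(φ - sD)`. Hence `(1 - r)²` cancels, and the limit only needs `φ → 1` and `D →
    -- -2πim`.
    have hid : ∀ n, (1 - r n) * poissonPP u v p q (r n) ((1 - r n) * s) =
        (1 + r n) * ‖stepChar u v p q ((1 - r n) * s)‖ ^ 2 / ‖stepChar u v p q ((1 - r n) * s)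
        - s * dslope (stepChar u v p q) 0 ((1 - r n) * s)‖ ^ 2 := by
      intro n
      have h3 := sub_smul_dslope (stepChar u v p q) 0 ((1 - r n) * s)
      rw [stepChar_zero u v p q hq, sub_zero] at h3
      have h4 : 1 - r n * stepChar u v p q ((1 - r n) * s) = ((1 - r n : ℝ) : ℂ) *
          (stepChar u v p q ((1 - r n) * s) - s * dslope (stepChar u v p q) 0 ((1 - r n) * s)) := by
        rw [Complex.real_smul] at h3
        push_cast at h3 ⊢
        linear_combination h3
      unfold poissonPP
      rw [h4, norm_mul, Complex.norm_real, Real.norm_of_nonneg (hε n).le, mul_pow,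
        ← mul_div_mul_left ((1 + r n) * ‖stepChar u v p q ((1 - r n) * s)‖ ^ 2) _
          (pow_ne_zero 2 (hε n).ne'), ← mul_div_assoc]
      congr 1; ring
    have key : Tendsto (fun n => (1 - r n) * poissonPP u v p q (r n) ((1 - r n) * s)) atTop
        (𝓝 (2 * (1 + ((2 * Real.pi * m) * s) ^ 2)⁻¹)) := by
      simp_rw [hid]
      have h5 := ((hr.const_add 1).mul (hφ.norm.pow 2)).div hnorm (by positivity)
      have h6 : (1 + 1) * ‖(1 : ℂ)‖ ^ 2 / (1 + (2 * Real.pi * m * s) ^ 2) =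
          2 * (1 + ((2 * Real.pi * m) * s) ^ 2)⁻¹ := by rw [norm_one]; ring
      rw [h6] at h5
      exact h5
    refine (key.smul ((hF.tendsto 0).comp hεs)).congr' ?_
    filter_upwards [hmem] with n hn
    rw [Set.indicator_of_mem hn, smul_smul]
    simp [Function.comp]

end

/-! ### The limit `r → 1` of integrals against the Poisson kernel. -/

lemma countable_resonances {u : ℝ} (hu : 0 < u) (v : ℝ) : (resonances u v).Countable := by
  refine (Set.countable_range fun n : ℤ => (n : ℝ) / u).mono ?_
  rintro k ⟨⟨n, hn⟩, -⟩
  exact ⟨n, by simp only [← hn]; field_simp⟩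

/-- The map `z ↦ zu` embeds the resonances into `ℤ`, so the sum is dominated by one over integers.
-/
lemma summable_resonances {u : ℝ} (hu : 0 < u) (v : ℝ) :
    Summable fun z : resonances u v => (1 + (z : ℝ) ^ 2)⁻¹ := by
  choose n hn using fun z : resonances u v => z.2.1
  have hinj : Function.Injective n := by
    intro a b hab
    have := hn a
    rw [hab, ← hn b] at this
    exact Subtype.ext (mul_right_cancel₀ hu.ne' this)
  have hs : Summable fun m : ℤ => (1 + ((m : ℝ) / u) ^ 2)⁻¹ := by
    have h1 := (Real.summable_one_div_int_pow (p := 2)).2 (by norm_num)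
    refine Summable.of_norm_bounded_eventually (h1.mul_left (u ^ 2)) ?_
    filter_upwards [(Set.finite_singleton (0 : ℤ)).compl_mem_cofinite] with m hm
    have hm0 : (m : ℝ) ≠ 0 := by exact_mod_cast hm
    rw [Real.norm_of_nonneg (by positivity), div_pow,
      show u ^ 2 * (1 / (m : ℝ) ^ 2) = ((m : ℝ) ^ 2 / u ^ 2)⁻¹ by field_simp]
    apply inv_anti₀ (by positivity)
    linarith
  have := hs.comp_injective hinj
  refine this.congr fun z => ?_
  simp only [Function.comp, ← hn z]
  rw [mul_div_cancel_right₀ _ hu.ne']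

lemma exists_seq_tendsto_one :
    ∃ r : ℕ → ℝ, (∀ n, 0 < r n) ∧ (∀ n, r n < 1) ∧ Tendsto r atTop (𝓝 1) := by
  refine ⟨fun n : ℕ => 1 - 1 / ((n : ℝ) + 2), fun n => ?_, fun n => ?_, ?_⟩
  · have : 1 / ((n : ℝ) + 2) < 1 := by
      rw [div_lt_one (by positivity)]; linarith [n.cast_nonneg (α := ℝ)]
    linarith
  · have : 0 < 1 / ((n : ℝ) + 2) := by positivity
    linarith
  · have : Tendsto (fun n : ℕ => 1 / ((n : ℝ) + 2)) atTop (𝓝 0) :=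
      tendsto_const_nhds.div_atTop (tendsto_atTop_add_const_right _ _ tendsto_natCast_atTop_atTop)
    simpa only [sub_zero] using this.const_sub 1

/-- The limit of the first summand of the Poisson kernel. -/
def poissonLimit (u v p q k : ℝ) : ℝ :=
  (1 - ‖stepChar u v p q k‖ ^ 2) / ‖1 - stepChar u v p q k‖ ^ 2

section
variable {u v p q : ℝ} (hu : 0 < u) (hv : 0 < v) (hq : q = 1 - p) (hpq : 0 < p * q)
include hq hpq

lemma poissonLimit_nonneg (k : ℝ) : 0 ≤ poissonLimit u v p q k :=
  div_nonneg (by linarith [norm_stepChar_sq_le (u := u) (v := v) hq hpq k]) (by positivity)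

/-- Supplies a dominating function independent of `r`; the `4` is the square of the constant in
`norm_one_sub_le`. -/
lemma poissonAC_le_poissonLimit {r : ℝ} (h0 : 0 ≤ r) (h1 : r < 1) {k : ℝ}
    (hk : k ∉ resonances u v) : poissonAC u v p q r k ≤ 4 * poissonLimit u v p q k := by
  have h2 := norm_one_sub_le (norm_stepChar_le u v p q k hq hpq) h0 h1.le
  have h3 := norm_stepChar_sq_le (u := u) (v := v) hq hpq k
  have h4 : 0 < ‖1 - stepChar u v p q k‖ := by
    rw [norm_pos_iff, sub_ne_zero, ne_comm, Ne, stepChar_eq_one_iff u v p q k hq hpq]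
    exact hk
  unfold poissonAC poissonLimit
  have h5 : 0 ≤ 1 - ‖stepChar u v p q k‖ ^ 2 := by linarith
  calc _ ≤ (1 - ‖stepChar u v p q k‖ ^ 2) / (‖1 - stepChar u v p q k‖ / 2) ^ 2 := by
        gcongr; linarith
    _ = _ := by field_simp; norm_num

lemma tendsto_poissonAC {r : ℕ → ℝ} (hr : Tendsto r atTop (𝓝 1)) {k : ℝ}
    (hk : k ∉ resonances u v) :
    Tendsto (fun n => poissonAC u v p q (r n) k) atTop (𝓝 (poissonLimit u v p q k)) := by
  have h4 : ‖1 - stepChar u v p q k‖ ^ 2 ≠ 0 := by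
    rw [pow_ne_zero_iff two_ne_zero, norm_ne_zero_iff, sub_ne_zero, ne_comm, Ne,
      stepChar_eq_one_iff u v p q k hq hpq]
    exact hk
  unfold poissonAC poissonLimit
  refine Tendsto.div tendsto_const_nhds ?_ h4
  have hr' : Tendsto (fun n => (r n : ℂ)) atTop (𝓝 1) := by
    exact_mod_cast (Complex.continuous_ofReal.tendsto 1).comp hr
  have := (((hr'.mul_const (stepChar u v p q k)).const_sub 1).norm).pow 2
  simpa using this

lemma integrable_inv_mul_poisson {r : ℝ} (h0 : 0 ≤ r) (h1 : r < 1) :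
    Integrable fun k => (1 + k ^ 2)⁻¹ * poisson u v p q r k := by
  have hc := continuous_poissonPP (u := u) (v := v) hq hpq h0 h1
  have hc2 := continuous_poissonAC (u := u) (v := v) hq hpq h0 h1
  refine (integrable_inv_one_add_sq.mul_const (2 / (1 - r) ^ 2)).mono' ?_ ?_
  · have : Measurable (poisson u v p q r) := by
      have : poisson u v p q r = fun k => poissonAC u v p q r k + poissonPP u v p q r k :=
        funext fun k => poisson_eq_add u v p q r k
      rw [this]; exact (hc2.add hc).measurable
    exact (by fun_prop : Measurable _).aestronglyMeasurable
  · refine Eventually.of_forall fun k => ?_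
    have hp := poisson_nonneg (u := u) (v := v) hq hpq h0 h1 k
    rw [Real.norm_of_nonneg (by positivity)]
    have e1 := poissonAC_le (u := u) (v := v) hq hpq h0 h1 k
    have e2 := poissonPP_le_inv (u := u) (v := v) hq hpq h0 h1 k
    have e3 : poisson u v p q r k ≤ 2 / (1 - r) ^ 2 := by
      rw [poisson_eq_add, ← one_add_one_eq_two, add_div]; linarith
    gcongr

include hu in
/-- A uniform bound on the Poisson kernels makes the limit density tempered. -/
lemma integrable_poissonLimit {C : ℝ} (hC : ∀ r : ℝ, 0 < r → r < 1 →
      ∫ k, (1 + k ^ 2)⁻¹ * poisson u v p q r k ≤ C) :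
    Integrable fun k => (1 + k ^ 2)⁻¹ * poissonLimit u v p q k := by
  obtain ⟨r, h0, h1, hr⟩ := exists_seq_tendsto_one
  have hmeas : ∀ n, AEStronglyMeasurable (fun k => (1 + k ^ 2)⁻¹ * poissonAC u v p q (r n) k) volume := by
    intro n
    have h2 := (continuous_poissonAC (u := u) (v := v) hq hpq (h0 n).le (h1 n)).measurable
    exact (by fun_prop : Measurable _).aestronglyMeasurable
  -- Fatou's lemma: almost everywhere convergence together with a bounded liminf of the integrals.
  refine integrable_of_tendsto (G := fun n k => (1 + k ^ 2)⁻¹ * poissonAC u v p q (r n) k) ?_ hmeas ?_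
  · have : ∀ᵐ k : ℝ, k ∉ resonances u v := (countable_resonances hu v).ae_notMem volume
    filter_upwards [this] with k hk
    exact (tendsto_poissonAC hq hpq hr hk).const_mul _
  · have hle : ∀ n, ∫⁻ k, ‖(1 + k ^ 2)⁻¹ * poissonAC u v p q (r n) k‖ₑ ≤ ENNReal.ofReal C := by
      intro n
      have hint := integrable_inv_mul_poisson (u := u) (v := v) hq hpq (h0 n).le (h1 n)
      calc _ ≤ ∫⁻ k, ENNReal.ofReal ((1 + k ^ 2)⁻¹ * poisson u v p q (r n) k) := by
            refine lintegral_mono fun k => ?_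
            have hp := poissonAC_nonneg (u := u) (v := v) hq hpq (r n) k
            have hp2 := poissonPP_nonneg (u := u) (v := v) (p := p) (q := q) (h0 n).le (h1 n) k
            rw [Real.enorm_of_nonneg (by positivity)]
            apply ENNReal.ofReal_le_ofReal
            rw [poisson_eq_add]
            gcongr
            linarith
        _ = ENNReal.ofReal (∫ k, (1 + k ^ 2)⁻¹ * poisson u v p q (r n) k) := by
            rw [ofReal_integral_eq_lintegral_ofReal hint]
            exact Eventually.of_forall fun k => mul_nonneg (by positivity)
              (poisson_nonneg hq hpq (h0 n).le (h1 n) k)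
        _ ≤ _ := ENNReal.ofReal_le_ofReal (hC _ (h0 n) (h1 n))
    refine ne_top_of_le_ne_top (ENNReal.ofReal_ne_top (r := C)) ?_
    refine liminf_le_of_le (by isBoundedDefault) fun b hb => ?_
    obtain ⟨n, hn⟩ := hb.exists
    exact hn.trans (hle n)

include hu in
lemma tendsto_integral_poissonAC {f : ℝ → ℂ} (hf : Continuous f) {M : ℝ}
    (hM : ∀ k, ‖f k‖ ≤ M * (1 + k ^ 2)⁻¹)
    (hint : Integrable fun k => (1 + k ^ 2)⁻¹ * poissonLimit u v p q k) {r : ℕ → ℝ}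
    (h0 : ∀ n, 0 < r n) (h1 : ∀ n, r n < 1) (hr : Tendsto r atTop (𝓝 1)) :
    Tendsto (fun n => ∫ k, poissonAC u v p q (r n) k • f k) atTop
      (𝓝 (∫ k, poissonLimit u v p q k • f k)) := by
  have hae : ∀ᵐ k : ℝ, k ∉ resonances u v := (countable_resonances hu v).ae_notMem volume
  refine tendsto_integral_of_dominated_convergence
    (fun k => 4 * M * ((1 + k ^ 2)⁻¹ * poissonLimit u v p q k)) ?_ (hint.const_mul _) ?_ ?_
  · intro n
    exact ((continuous_poissonAC hq hpq (h0 n).le (h1 n)).smul hf).aestronglyMeasurable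
  · intro n
    filter_upwards [hae] with k hk
    have h2 := poissonAC_le_poissonLimit hq hpq (h0 n).le (h1 n) hk
    have h3 := poissonAC_nonneg (u := u) (v := v) hq hpq (r n) k
    have h4 := poissonLimit_nonneg (u := u) (v := v) hq hpq k
    rw [norm_smul, Real.norm_of_nonneg h3]
    calc _ ≤ (4 * poissonLimit u v p q k) * (M * (1 + k ^ 2)⁻¹) := by
          gcongr; exact hM k
      _ = _ := by ring
  · filter_upwards [hae] with k hk
    exact (tendsto_poissonAC hq hpq hr hk).smul_const _

lemma integrable_poissonPP_smul {f : ℝ → ℂ} (hf : Continuous f) {M : ℝ}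
    (hM : ∀ k, ‖f k‖ ≤ M * (1 + k ^ 2)⁻¹) {r : ℝ} (h0 : 0 ≤ r) (h1 : r < 1) :
    Integrable fun k => poissonPP u v p q r k • f k := by
  refine (integrable_inv_one_add_sq.const_mul (1 / (1 - r) ^ 2 * M)).mono'
    ((continuous_poissonPP hq hpq h0 h1).smul hf).aestronglyMeasurable
    (Eventually.of_forall fun k => ?_)
  rw [norm_smul, Real.norm_of_nonneg (poissonPP_nonneg h0 h1 k), mul_assoc]
  gcongr
  · exact poissonPP_le_inv hq hpq h0 h1 k
  · exact hM k

lemma integrable_poissonAC_smul {f : ℝ → ℂ} (hf : Continuous f) {M : ℝ}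
    (hM : ∀ k, ‖f k‖ ≤ M * (1 + k ^ 2)⁻¹) {r : ℝ} (h0 : 0 ≤ r) (h1 : r < 1) :
    Integrable fun k => poissonAC u v p q r k • f k := by
  refine (integrable_inv_one_add_sq.const_mul (1 / (1 - r) ^ 2 * M)).mono'
    ((continuous_poissonAC hq hpq h0 h1).smul hf).aestronglyMeasurable
    (Eventually.of_forall fun k => ?_)
  rw [norm_smul, Real.norm_of_nonneg (poissonAC_nonneg hq hpq r k), mul_assoc]
  gcongr
  · exact poissonAC_le hq hpq h0 h1 k
  · exact hM k

end

/-- The closed intervals of half-width `1 / (4u)` around the resonances. -/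
def resonanceNhds (u v : ℝ) : Set ℝ :=
  ⋃ z : resonances u v, Set.Icc ((z : ℝ) - 1 / (4 * u)) (z + 1 / (4 * u))

lemma measurableSet_resonanceNhds {u : ℝ} (hu : 0 < u) (v : ℝ) :
    MeasurableSet (resonanceNhds u v) := by
  have := (countable_resonances hu v).to_subtype
  exact MeasurableSet.iUnion fun z => measurableSet_Icc

lemma pairwise_disjoint_resonanceNhds {u : ℝ} (hu : 0 < u) (v : ℝ) :
    Pairwise (Function.onFun Disjoint fun z : resonances u v =>
      Set.Icc ((z : ℝ) - 1 / (4 * u)) (z + 1 / (4 * u))) := by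
  intro a b hab
  rw [Function.onFun, Set.disjoint_left]
  intro x hxa hxb
  have h1 := abs_ge_of_mem_resonances hu (resonances_sub a.2 b.2)
    (sub_ne_zero.2 fun h => hab (Subtype.ext h))
  have h2 : |(a : ℝ) - b| ≤ 2 * (1 / (4 * u)) := by
    rw [abs_le]; constructor <;> linarith [hxa.1, hxa.2, hxb.1, hxb.2]
  have h3 : 2 * (1 / (4 * u)) < 1 / u := by
    rw [show 2 * (1 / (4 * u)) = 1 / u / 2 by field_simp; norm_num]
    have : 0 < 1 / u := by positivity
    linarith
  linarith

section
variable {u v p q : ℝ} (hu : 0 < u) (hv : 0 < v) (hq : q = 1 - p) (hpq : 0 < p * q)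
include hq hpq hu hv

/-- Translation by a resonance does not change `φ`, so each interval carries a copy of the peak at
`0`. The peak masses are uniformly bounded and `f` decays summably along the resonances, so limit
and sum may be exchanged. -/
lemma tendsto_integral_poissonPP_nhds {f : ℝ → ℂ} (hf : Continuous f) {M : ℝ}
    (hM : ∀ k, ‖f k‖ ≤ M * (1 + k ^ 2)⁻¹) {r : ℕ → ℝ}
    (h0 : ∀ n, 0 < r n) (h1 : ∀ n, r n < 1) (hr : Tendsto r atTop (𝓝 1)) :
    Tendsto (fun n => ∫ k in resonanceNhds u v, poissonPP u v p q (r n) k • f k) atTop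
      (𝓝 (∑' z : resonances u v, (1 / (p * u + q * v) : ℝ) • f z)) := by
  have hcount := (countable_resonances hu v).to_subtype
  set δ := 1 / (4 * u) with hδ
  have hM0 : 0 ≤ M := by
    have := (norm_nonneg _).trans (hM 0); simpa using this
  have e : ∀ n, ∫ k in resonanceNhds u v, poissonPP u v p q (r n) k • f k =
      ∑' z : resonances u v, ∫ t in Set.Icc (-δ) δ, poissonPP u v p q (r n) t • f (z + t) := by
    intro n
    rw [resonanceNhds, (hasSum_integral_iUnion (fun z => measurableSet_Icc)
      (pairwise_disjoint_resonanceNhds hu v)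
      (integrable_poissonPP_smul hq hpq hf hM (h0 n).le (h1 n)).integrableOn).tsum_eq.symm]
    congr 1
    ext z
    rw [← integral_indicator measurableSet_Icc, ← integral_indicator measurableSet_Icc,
      ← integral_add_left_eq_self _ (z : ℝ)]
    congr 1
    ext t
    have hmem : (z : ℝ) + t ∈ Set.Icc ((z : ℝ) - 1 / (4 * u)) (z + 1 / (4 * u)) ↔ t ∈ Set.Icc (-δ) δ := by
      simp only [Set.mem_Icc]; constructor <;> rintro ⟨a, b⟩ <;> constructor <;> linarith
    by_cases ht : t ∈ Set.Icc (-δ) δ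
    · rw [Set.indicator_of_mem (hmem.2 ht), Set.indicator_of_mem ht]
      simp only [poissonPP, stepChar_add z.2]
    · rw [Set.indicator_of_notMem (fun h => ht (hmem.1 h)), Set.indicator_of_notMem ht]
  simp_rw [e]
  obtain ⟨C, hC⟩ := exists_integral_poissonPP_le hu hv hq hpq
  refine tendsto_tsum_of_dominated_convergence
    (bound := fun z : resonances u v => C * (M * (2 + 2 * δ ^ 2) * (1 + (z : ℝ) ^ 2)⁻¹)) ?_ ?_ ?_
  · exact ((summable_resonances hu v).mul_left _).mul_left _
  · intro z
    have := tendsto_integral_poissonPP_local hu hv hq hpq (F := fun t => f (z + t))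
      (by fun_prop) h0 h1 hr
    simpa only [add_zero] using this
  · refine Eventually.of_forall fun n z => ?_
    -- From `z² ≤ 2(z + t)² + 2t²` one gets `1 + z² ≤ (2 + 2δ²)(1 + (z + t)²)`.
    have hb : ∀ t ∈ Set.Icc (-δ) δ, ‖f (z + t)‖ ≤ M * (2 + 2 * δ ^ 2) * (1 + (z : ℝ) ^ 2)⁻¹ := by
      intro t ht
      refine (hM _).trans ?_
      rw [mul_assoc]
      gcongr
      rw [← div_eq_mul_inv, inv_eq_one_div, div_le_div_iff₀ (by positivity) (by positivity)]
      have : t ^ 2 ≤ δ ^ 2 := sq_le_sq' ht.1 ht.2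
      nlinarith [sq_nonneg ((z : ℝ) + 2 * t), sq_nonneg ((z : ℝ) + t), mul_nonneg (sq_nonneg δ) (sq_nonneg ((z : ℝ) + t))]
    have hcB := continuous_poissonPP (u := u) (v := v) hq hpq (h0 n).le (h1 n)
    calc _ ≤ ∫ t in Set.Icc (-δ) δ, poissonPP u v p q (r n) t * (M * (2 + 2 * δ ^ 2) * (1 + (z : ℝ) ^ 2)⁻¹) := by
          refine norm_integral_le_of_norm_le ?_ ?_
          · exact (hcB.mul continuous_const).continuousOn.integrableOn_Icc
          · filter_upwards [ae_restrict_mem measurableSet_Icc] with t ht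
            have hp := poissonPP_nonneg (u := u) (v := v) (p := p) (q := q) (h0 n).le (h1 n) t
            rw [norm_smul, Real.norm_of_nonneg hp]
            exact mul_le_mul_of_nonneg_left (hb t ht) hp
      _ ≤ _ := by
          rw [integral_mul_const]
          exact mul_le_mul_of_nonneg_right (hC _ (h0 n) (h1 n)) (by positivity)

omit hv in
-- On a bounded set away from the resonances the summand is uniformly `O(1 - r²)`. For large `|k|`
-- one of the two factors `(1 + k²)⁻¹` bounding `f` is small, while the other is absorbed by the
-- uniform bound `hC`; hence the squared weight.
lemma tendsto_integral_poissonPP_compl {f : ℝ → ℂ} {M : ℝ}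
    (hM : ∀ k, ‖f k‖ ≤ M * ((1 + k ^ 2)⁻¹) ^ 2) {C : ℝ} (hC : ∀ r : ℝ, 0 < r → r < 1 →
      ∫ k, (1 + k ^ 2)⁻¹ * poisson u v p q r k ≤ C) {r : ℕ → ℝ}
    (h0 : ∀ n, 0 < r n) (h1 : ∀ n, r n < 1) (hr : Tendsto r atTop (𝓝 1)) :
    Tendsto (fun n => ∫ k in (resonanceNhds u v)ᶜ, poissonPP u v p q (r n) k • f k) atTop (𝓝 0) := by
  have hM0 : 0 ≤ M := by
    have := (norm_nonneg _).trans (hM 0); simpa using this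
  rw [Metric.tendsto_nhds]
  intro ε hε
  -- Chosen so that `M η |C| < ε`; then `|k| ≥ 1 + 1/η` forces `(1 + k²)⁻¹ ≤ η`.
  set η := ε / (2 * (M * |C| + 1)) with hη
  have hη0 : 0 < η := by positivity
  set K := 1 + 1 / η with hK
  have hK0 : 0 < K := by positivity
  -- Open balls are removed so that `V` is compact and `|1 - φ|` has a positive lower bound on it.
  set V : Set ℝ := Set.Icc (-K) K ∩ ⋂ z ∈ resonances u v, (Metric.ball z (1 / (4 * u)))ᶜ with hV
  have hVc : IsCompact V := isCompact_Icc.inter_right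
    (isClosed_biInter fun z _ => Metric.isOpen_ball.isClosed_compl)
  obtain ⟨c, hc, hcV⟩ := hVc.exists_forall_le' (f := fun k => ‖1 - stepChar u v p q k‖) (a := 0)
    (by have := continuous_stepChar u v p q; fun_prop) (by
      intro k hk
      rw [norm_pos_iff, sub_ne_zero, ne_comm, Ne, stepChar_eq_one_iff u v p q k hq hpq]
      intro hkr
      have := Set.mem_iInter₂.1 hk.2 k hkr
      exact this (Metric.mem_ball_self (by positivity)))
  have hmain : ∀ n, ‖∫ k in (resonanceNhds u v)ᶜ, poissonPP u v p q (r n) k • f k‖ ≤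
      M * (η * |C| + (1 - r n ^ 2) * (4 / c ^ 2) * (2 * K)) := by
    intro n
    have hr2 : 0 ≤ 1 - r n ^ 2 := by nlinarith [h0 n, h1 n]
    have hI := integrable_inv_mul_poisson (u := u) (v := v) hq hpq (h0 n).le (h1 n)
    have hJ : Integrable ((Set.Icc (-K) K).indicator fun _ : ℝ => (1 - r n ^ 2) * (4 / c ^ 2)) :=
      (integrable_indicator_iff measurableSet_Icc).2 (integrableOn_const (by simp))
    rw [← integral_indicator (measurableSet_resonanceNhds hu v).compl]
    calc _ ≤ ∫ k, M * (η * ((1 + k ^ 2)⁻¹ * poisson u v p q (r n) k) +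
          (Set.Icc (-K) K).indicator (fun _ : ℝ => (1 - r n ^ 2) * (4 / c ^ 2)) k) := by
          refine norm_integral_le_of_norm_le (((hI.const_mul η).add hJ).const_mul M)
            (Eventually.of_forall fun k => ?_)
          have hp := poisson_nonneg (u := u) (v := v) hq hpq (h0 n).le (h1 n) k
          have hind : 0 ≤ (Set.Icc (-K) K).indicator (fun _ : ℝ => (1 - r n ^ 2) * (4 / c ^ 2)) k :=
            Set.indicator_nonneg (fun _ _ => by positivity) _
          by_cases hkU : k ∈ (resonanceNhds u v)ᶜ
          · have hpp := poissonPP_nonneg (u := u) (v := v) (p := p) (q := q) (h0 n).le (h1 n) k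
            have hac := poissonAC_nonneg (u := u) (v := v) hq hpq (r n) k
            have hw1 : (1 + k ^ 2)⁻¹ ≤ 1 := inv_le_one_of_one_le₀ (by nlinarith [sq_nonneg k])
            have hw0 : 0 < (1 + k ^ 2)⁻¹ := by positivity
            rw [Set.indicator_of_mem hkU, norm_smul, Real.norm_of_nonneg hpp]
            have key : poissonPP u v p q (r n) k * ((1 + k ^ 2)⁻¹) ^ 2 ≤
                η * ((1 + k ^ 2)⁻¹ * poisson u v p q (r n) k) +
                (Set.Icc (-K) K).indicator (fun _ : ℝ => (1 - r n ^ 2) * (4 / c ^ 2)) k := by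
              by_cases hkK : k ∈ Set.Icc (-K) K
              · rw [Set.indicator_of_mem hkK]
                have hkV : k ∈ V := by
                  refine ⟨hkK, Set.mem_iInter₂.2 fun z hz hb => hkU ?_⟩
                  refine Set.mem_iUnion.2 ⟨⟨z, hz⟩, ?_⟩
                  rw [Metric.mem_ball, Real.dist_eq, abs_lt] at hb
                  exact ⟨by linarith [hb.1], by linarith [hb.2]⟩
                have h5 := poissonPP_le hq hpq (h0 n).le (h1 n) hc (hcV k hkV)
                have h6 : ((1 + k ^ 2)⁻¹) ^ 2 ≤ 1 := pow_le_one₀ hw0.le hw1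
                have h7 : 0 ≤ η * ((1 + k ^ 2)⁻¹ * poisson u v p q (r n) k) := by positivity
                nlinarith
              · rw [Set.indicator_of_notMem hkK, add_zero]
                have hk2 : K ≤ |k| := by
                  by_contra hlt
                  rw [not_le, abs_lt] at hlt
                  exact hkK ⟨hlt.1.le, hlt.2.le⟩
                have hk3 : (1 + k ^ 2)⁻¹ ≤ η := by
                  rw [inv_le_comm₀ (by positivity) hη0, ← sq_abs, ← one_div]
                  have : 1 / η ≤ |k| := by linarith
                  have h1k : 1 ≤ |k| := by
                    have : 0 < 1 / η := by positivity
                    linarith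
                  nlinarith
                have h8 : poissonPP u v p q (r n) k ≤ poisson u v p q (r n) k := by
                  rw [poisson_eq_add]; linarith
                calc _ = (1 + k ^ 2)⁻¹ * ((1 + k ^ 2)⁻¹ * poissonPP u v p q (r n) k) := by ring
                  _ ≤ _ := by gcongr
            calc _ ≤ poissonPP u v p q (r n) k * (M * ((1 + k ^ 2)⁻¹) ^ 2) := by
                  gcongr; exact hM k
              _ = M * (poissonPP u v p q (r n) k * ((1 + k ^ 2)⁻¹) ^ 2) := by ring
              _ ≤ _ := by gcongr
          · rw [Set.indicator_of_notMem hkU, norm_zero]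
            positivity
      _ = M * (η * (∫ k, (1 + k ^ 2)⁻¹ * poisson u v p q (r n) k) +
            (1 - r n ^ 2) * (4 / c ^ 2) * (2 * K)) := by
          rw [integral_const_mul, integral_add (hI.const_mul η) hJ, integral_const_mul,
            integral_indicator measurableSet_Icc, setIntegral_const]
          simp only [measureReal_def, Real.volume_Icc, smul_eq_mul]
          rw [ENNReal.toReal_ofReal (by linarith)]
          ring
      _ ≤ _ := by
          gcongr
          exact (hC _ (h0 n) (h1 n)).trans (le_abs_self C)
  have hlim : Tendsto (fun n => M * (η * |C| + (1 - r n ^ 2) * (4 / c ^ 2) * (2 * K))) atTop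
      (𝓝 (M * (η * |C|))) := by
    have := (((((hr.pow 2).const_sub 1).mul_const (4 / c ^ 2)).mul_const (2 * K)).const_add
      (η * |C|)).const_mul M
    simpa using this
  have hlt : M * (η * |C|) < ε := by
    have h9 : M * |C| / (2 * (M * |C| + 1)) < 1 := by
      have : 0 ≤ M * |C| := by positivity
      rw [div_lt_one (by positivity)]; linarith
    calc _ = ε * (M * |C| / (2 * (M * |C| + 1))) := by rw [hη]; ring
      _ < ε * 1 := by gcongr
      _ = ε := mul_one _
  filter_upwards [hlim.eventually (gt_mem_nhds hlt)] with n hn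
  rw [dist_zero_right]
  exact (hmain n).trans_lt hn

theorem tendsto_integral_poisson {f : ℝ → ℂ} (hf : Continuous f) {M : ℝ}
    (hM : ∀ k, ‖f k‖ ≤ M * ((1 + k ^ 2)⁻¹) ^ 2) {C : ℝ} (hC : ∀ r : ℝ, 0 < r → r < 1 →
      ∫ k, (1 + k ^ 2)⁻¹ * poisson u v p q r k ≤ C) {r : ℕ → ℝ}
    (h0 : ∀ n, 0 < r n) (h1 : ∀ n, r n < 1) (hr : Tendsto r atTop (𝓝 1)) :
    Tendsto (fun n => ∫ k, poisson u v p q (r n) k • f k) atTop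
      (𝓝 ((∫ k, poissonLimit u v p q k • f k) +
        ∑' z : resonances u v, (1 / (p * u + q * v) : ℝ) • f z)) := by
  have hM0 : 0 ≤ M := by
    have := (norm_nonneg _).trans (hM 0); simpa using this
  have hM' : ∀ k, ‖f k‖ ≤ M * (1 + k ^ 2)⁻¹ := fun k => by
    refine (hM k).trans ?_
    gcongr
    exact pow_le_of_le_one (by positivity) (inv_le_one_of_one_le₀ (by nlinarith [sq_nonneg k])) two_ne_zero
  have a1 := tendsto_integral_poissonAC hu hq hpq hf hM' (integrable_poissonLimit hu hq hpq hC) h0 h1 hr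
  have a2 := tendsto_integral_poissonPP_nhds hu hv hq hpq hf hM' h0 h1 hr
  have a3 := tendsto_integral_poissonPP_compl hu hq hpq hM hC h0 h1 hr
  have a4 := a1.add (a2.add a3)
  rw [add_zero] at a4
  refine a4.congr fun n => ?_
  rw [integral_add_compl (measurableSet_resonanceNhds hu v)
    (integrable_poissonPP_smul hq hpq hf hM' (h0 n).le (h1 n)),
    ← integral_add (integrable_poissonAC_smul hq hpq hf hM' (h0 n).le (h1 n))
      (integrable_poissonPP_smul hq hpq hf hM' (h0 n).le (h1 n))]
  simp_rw [poisson_eq_add, add_smul]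

end

/-! ### Displacement laws and Abel summation of their Fourier transforms. -/

/-- Probability of a word of independent letters. -/
def wordWeight (p q : ℝ) {n : ℕ} (w : Fin n → Bool) : ℝ := ∏ i, if w i then p else q

/-- Total length of the tiles coded by a word. -/
def wordLength (u v : ℝ) {n : ℕ} (w : Fin n → Bool) : ℝ := ∑ i, tileLength u v (w i)

/-- The law of the displacement between the left endpoints of tiles number `0` and `n`. -/
def displacementLaw (u v p q : ℝ) (n : ℤ) : Measure ℝ :=
  ∑ w : Fin n.natAbs → Bool, ENNReal.ofReal (wordWeight p q w) •
    Measure.dirac ((n.sign : ℝ) * wordLength u v w)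

/-- The autocorrelation of the random tiling. -/
def tilingAutocorrelation (u v p q d : ℝ) : Measure ℝ :=
  ENNReal.ofReal d • Measure.sum fun n : ℤ => displacementLaw u v p q n

/-- The characteristic function of `displacementLaw`. -/
def displacementChar (u v p q : ℝ) (n : ℤ) (k : ℝ) : ℂ :=
  match n with
  | Int.ofNat n => stepChar u v p q k ^ n
  | Int.negSucc n => (starRingEnd ℂ) (stepChar u v p q k) ^ (n + 1)

lemma wordWeight_nonneg {p q : ℝ} (hp : 0 ≤ p) (hq : 0 ≤ q) {n : ℕ} (w : Fin n → Bool) :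
    0 ≤ wordWeight p q w :=
  Finset.prod_nonneg fun i _ => by split_ifs <;> assumption

lemma sum_wordWeight {p q : ℝ} (hq : q = 1 - p) (n : ℕ) :
    ∑ w : Fin n → Bool, wordWeight p q w = 1 := by
  calc _ = (∑ b : Bool, if b then p else q) ^ n :=
        (Fintype.sum_pow (fun b : Bool => if b then p else q) n).symm
    _ = 1 := by simp [hq]

lemma le_wordLength {u v c : ℝ} (hcu : c ≤ u) (hcv : c ≤ v) {n : ℕ} (w : Fin n → Bool) :
    n * c ≤ wordLength u v w := by
  have : ∑ _i : Fin n, c ≤ wordLength u v w := by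
    refine Finset.sum_le_sum fun i _ => ?_
    unfold tileLength
    split_ifs <;> assumption
  simpa using this

/-- Displacements grow at least linearly in `n`; every summation over `n` below rests on this. -/
lemma natAbs_mul_le_abs {u v c : ℝ} (hcu : c ≤ u) (hcv : c ≤ v) (n : ℤ)
    (w : Fin n.natAbs → Bool) : n.natAbs * c ≤ |(n.sign : ℝ) * wordLength u v w| := by
  have h := le_wordLength hcu hcv w
  rcases eq_or_ne n 0 with rfl | hn
  · simp
  · have : |(n.sign : ℝ)| = 1 := by
      rw [← Int.cast_abs, Int.abs_sign_of_ne_zero hn]; simp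
    rw [abs_mul, this, one_mul]
    exact h.trans (le_abs_self _)

lemma integral_displacementLaw {p q : ℝ} (hp : 0 ≤ p) (hq : 0 ≤ q) (u v : ℝ) (n : ℤ) (f : ℝ → ℂ) :
    ∫ x, f x ∂displacementLaw u v p q n =
      ∑ w : Fin n.natAbs → Bool, wordWeight p q w • f ((n.sign : ℝ) * wordLength u v w) := by
  unfold displacementLaw
  rw [integral_finsetSum_measure]
  · refine Finset.sum_congr rfl fun w _ => ?_
    rw [integral_smul_measure, integral_dirac, ENNReal.toReal_ofReal (wordWeight_nonneg hp hq w)]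
  · intro w _
    exact (integrable_dirac (by simp)).smul_measure ENNReal.ofReal_ne_top

/-- Expanding the power of a two-term sum produces one term per word; conjugation accounts for the
sign of negative displacements. -/
lemma displacementChar_eq_sum (u v p q : ℝ) (n : ℤ) (k : ℝ) : displacementChar u v p q n k =
    ∑ w : Fin n.natAbs → Bool, (wordWeight p q w : ℂ) *
      Complex.exp ((-2 * Real.pi * k * ((n.sign : ℝ) * wordLength u v w) : ℝ) * Complex.I) := by
  have hs : stepChar u v p q k = ∑ b : Bool, ((if b then p else q : ℝ) : ℂ) *
      Complex.exp ((-(2 * Real.pi * k * tileLength u v b) : ℝ) * Complex.I) := by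
    simp [stepChar, tileLength]
  have hc : (starRingEnd ℂ) (stepChar u v p q k) = ∑ b : Bool, ((if b then p else q : ℝ) : ℂ) *
      Complex.exp ((2 * Real.pi * k * tileLength u v b : ℝ) * Complex.I) := by
    rw [hs, map_sum]
    refine Finset.sum_congr rfl fun b _ => ?_
    rw [map_mul, Complex.conj_ofReal, ← Complex.exp_conj, map_mul, Complex.conj_ofReal, Complex.conj_I]
    congr 2
    push_cast; ring
  match n with
  | Int.ofNat n =>
    simp only [displacementChar, hs]
    rw [Fintype.sum_pow]
    refine Finset.sum_congr rfl fun w _ => ?_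
    rw [Finset.prod_mul_distrib, wordWeight, Complex.ofReal_prod, ← Complex.exp_sum,
      ← Finset.sum_mul]
    congr 3
    rw [← Complex.ofReal_sum, wordLength]
    congr 1
    rcases Nat.eq_zero_or_pos n with rfl | hn
    · simp
    · rw [show Int.sign (Int.ofNat n) = 1 from Int.sign_eq_one_of_pos (by simpa using hn)]
      rw [Int.cast_one, one_mul, Finset.mul_sum]
      refine Finset.sum_congr rfl fun i _ => ?_
      ring
  | Int.negSucc n =>
    simp only [displacementChar, hc]
    rw [Fintype.sum_pow]
    refine Finset.sum_congr rfl fun w _ => ?_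
    rw [Finset.prod_mul_distrib, wordWeight, Complex.ofReal_prod, ← Complex.exp_sum,
      ← Finset.sum_mul]
    congr 3
    rw [← Complex.ofReal_sum, wordLength]
    congr 1
    rw [Int.sign_negSucc, Finset.mul_sum, Finset.mul_sum]
    refine Finset.sum_congr rfl fun i _ => ?_
    push_cast
    ring

lemma continuous_displacementChar (u v p q : ℝ) (n : ℤ) :
    Continuous (displacementChar u v p q n) := by
  have h := continuous_stepChar u v p q
  cases n with
  | ofNat n => exact h.pow n
  | negSucc n => exact (Complex.continuous_conj.comp h).pow (n + 1)

lemma norm_displacementChar_le {u v p q : ℝ} (hq : q = 1 - p) (hpq : 0 < p * q) (n : ℤ) (k : ℝ) :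
    ‖displacementChar u v p q n k‖ ≤ 1 := by
  have h := norm_stepChar_le u v p q k hq hpq
  cases n with
  | ofNat n =>
    simp only [displacementChar, norm_pow]
    exact pow_le_one₀ (norm_nonneg _) h
  | negSucc n =>
    simp only [displacementChar, norm_pow, RCLike.norm_conj]
    exact pow_le_one₀ (norm_nonneg _) h

lemma integral_fourier_displacementLaw {p q : ℝ} (hp : 0 ≤ p) (hq : 0 ≤ q) (u v : ℝ) (n : ℤ)
    {f : ℝ → ℂ} (hf : Integrable f) :
    ∫ x, 𝓕 f x ∂displacementLaw u v p q n = ∫ k, displacementChar u v p q n k * f k := by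
  rw [integral_displacementLaw hp hq]
  simp_rw [displacementChar_eq_sum, Finset.sum_mul]
  have hint : ∀ x : ℝ, Integrable fun k : ℝ =>
      Complex.exp ((-2 * Real.pi * k * x : ℝ) * Complex.I) * f k := by
    intro x
    refine hf.bdd_mul (c := 1) (by fun_prop : Continuous _).aestronglyMeasurable
      (Eventually.of_forall fun k => ?_)
    rw [Complex.norm_exp_ofReal_mul_I]
  rw [integral_finsetSum]
  · refine Finset.sum_congr rfl fun w _ => ?_
    rw [Real.fourier_real_eq_integral_exp_smul, Complex.real_smul, ← integral_const_mul]
    simp only [smul_eq_mul, mul_assoc]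
  · intro w _
    simp only [mul_assoc]
    exact Integrable.const_mul (by simpa only [mul_assoc] using hint _) _

section
variable {u v p q : ℝ} (hu : 0 < u) (hv : 0 < v) (hq : q = 1 - p) (hpq : 0 < p * q)
include hq hpq

/-- Two geometric series, in `rφ` for `n ≥ 0` and in `r conj(φ)` for `n < 0`, added over a common
denominator. -/
lemma hasSum_poisson {r : ℝ} (h0 : 0 ≤ r) (h1 : r < 1) (k : ℝ) :
    HasSum (fun n : ℤ => (r : ℂ) ^ n.natAbs * displacementChar u v p q n k)
      (poisson u v p q r k) := by
  set φ := stepChar u v p q k with hφ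
  have hz := norm_stepChar_le u v p q k hq hpq
  rw [← hφ] at hz
  have hn : ‖(r : ℂ) * φ‖ < 1 := by
    rw [norm_mul, Complex.norm_real, Real.norm_of_nonneg h0]
    nlinarith [norm_nonneg φ]
  have hn' : ‖(r : ℂ) * (starRingEnd ℂ) φ‖ < 1 := by
    rwa [norm_mul, RCLike.norm_conj, ← norm_mul]
  have a1 := hasSum_geometric_of_norm_lt_one hn
  have a2 := (hasSum_geometric_of_norm_lt_one hn').mul_left ((r : ℂ) * (starRingEnd ℂ) φ)
  have a3 := a1.int_rec a2
  have ef : (fun n : ℤ => (r : ℂ) ^ n.natAbs * displacementChar u v p q n k) = fun t : ℤ =>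
      Int.rec (fun n => ((r : ℂ) * φ) ^ n)
        (fun i => (r : ℂ) * (starRingEnd ℂ) φ * ((r : ℂ) * (starRingEnd ℂ) φ) ^ i) t := by
    funext n
    cases n with
    | ofNat n => simp only [displacementChar, ← hφ, mul_pow]; rfl
    | negSucc n =>
      simp only [displacementChar, ← hφ, Int.natAbs_negSucc, mul_pow]
      rw [pow_succ, pow_succ]; ring
  have ev : (poisson u v p q r k : ℂ) = (1 - (r : ℂ) * φ)⁻¹ +
      (r : ℂ) * (starRingEnd ℂ) φ * (1 - (r : ℂ) * (starRingEnd ℂ) φ)⁻¹ := by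
    have hne : 1 - (r : ℂ) * φ ≠ 0 := by
      intro h
      rw [← sub_eq_zero.1 h] at hn
      simp at hn
    have hne' : 1 - (r : ℂ) * (starRingEnd ℂ) φ ≠ 0 := by
      intro h
      rw [← sub_eq_zero.1 h] at hn'
      simp at hn'
    have e1 : ((‖1 - (r : ℂ) * φ‖ ^ 2 : ℝ) : ℂ) = (1 - (r : ℂ) * φ) * (1 - (r : ℂ) * (starRingEnd ℂ) φ) := by
      rw [← Complex.normSq_eq_norm_sq, ← Complex.mul_conj]
      simp
    have e2 : ((‖φ‖ ^ 2 : ℝ) : ℂ) = φ * (starRingEnd ℂ) φ := by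
      rw [← Complex.normSq_eq_norm_sq, ← Complex.mul_conj]
    rw [poisson, ← hφ, Complex.ofReal_div, e1, Complex.ofReal_sub, Complex.ofReal_mul, e2]
    have gen : ∀ x y : ℂ, 1 - x ≠ 0 → 1 - y ≠ 0 →
        (1 - x * y) / ((1 - x) * (1 - y)) = (1 - x)⁻¹ + y * (1 - y)⁻¹ := by
      intro x y hx hy
      field_simp
      ring
    rw [← gen _ _ hne hne']
    congr 1
    push_cast
    ring
  rw [ef, ev]
  exact a3

/-- The damping `r^|n|` makes the series absolutely summable in `L¹`, so that sum and integral may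
be exchanged. -/
lemma hasSum_integral_poisson {r : ℝ} (h0 : 0 ≤ r) (h1 : r < 1) {f : ℝ → ℂ} (hf : Integrable f) :
    HasSum (fun n : ℤ => (r : ℂ) ^ n.natAbs * ∫ x, 𝓕 f x ∂displacementLaw u v p q n)
      (∫ k, poisson u v p q r k • f k) := by
  obtain ⟨hp0, hq0⟩ := pos_of_mul_pos hq hpq
  have hbound : ∀ (n : ℤ) (k : ℝ), ‖displacementChar u v p q n k * f k‖ ≤ ‖f k‖ := by
    intro n k
    rw [norm_mul]
    exact mul_le_of_le_one_left (norm_nonneg _) (norm_displacementChar_le hq hpq n k)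
  have hi : ∀ n : ℤ, Integrable fun k => displacementChar u v p q n k * f k := fun n =>
    hf.norm.mono' ((continuous_displacementChar u v p q n).aestronglyMeasurable.mul
      hf.aestronglyMeasurable) (Eventually.of_forall (hbound n))
  have hgeo : Summable fun n : ℤ => r ^ n.natAbs := by
    have g := summable_geometric_of_lt_one h0 h1
    have := g.int_rec (g.mul_left r)
    refine this.congr fun n => ?_
    cases n with
    | ofNat n => rfl
    | negSucc n => simp only [Int.natAbs_negSucc, pow_succ]; ring
  have key := hasSum_integral_of_summable_integral_norm
    (F := fun (n : ℤ) k => (r : ℂ) ^ n.natAbs * (displacementChar u v p q n k * f k))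
    (fun n => (hi n).const_mul _) (by
      refine Summable.of_nonneg_of_le (fun n => integral_nonneg fun k => norm_nonneg _)
        (fun n => ?_) (hgeo.mul_right (∫ k, ‖f k‖))
      rw [← integral_const_mul]
      refine integral_mono ((hi n).const_mul _).norm (hf.norm.const_mul _) fun k => ?_
      simp only []
      rw [norm_mul, norm_pow, Complex.norm_real, Real.norm_of_nonneg h0]
      exact mul_le_mul_of_nonneg_left (hbound n k) (pow_nonneg h0 _))
  have ef : (fun n : ℤ => (r : ℂ) ^ n.natAbs * ∫ x, 𝓕 f x ∂displacementLaw u v p q n) =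
      fun n : ℤ => ∫ k, (r : ℂ) ^ n.natAbs * (displacementChar u v p q n k * f k) := by
    funext n
    rw [integral_fourier_displacementLaw hp0.le hq0.le u v n hf, integral_const_mul]
  have ev : ∫ k, poisson u v p q r k • f k =
      ∫ k, ∑' n : ℤ, (r : ℂ) ^ n.natAbs * (displacementChar u v p q n k * f k) := by
    congr 1
    funext k
    have := ((hasSum_poisson (u := u) (v := v) hq hpq h0 h1 k).mul_right (f k)).tsum_eq
    rw [Complex.real_smul, ← this]
    simp only [mul_assoc]
  rw [ef, ev]
  exact key

end

/-! ### A bound on the Poisson kernels uniform in `r`. -/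

lemma integrable_exp_neg_abs : Integrable fun x : ℝ =>
    ((Real.pi * Real.exp (-(2 * Real.pi) * |x|) : ℝ) : ℂ) := by
  have hpi : (0 : ℝ) < 2 * Real.pi := by positivity
  apply Integrable.ofReal
  apply Integrable.const_mul
  rw [← integrableOn_univ, ← Set.Iic_union_Ioi (a := (0 : ℝ))]
  refine IntegrableOn.union ?_ ?_
  · refine (integrableOn_exp_mul_Iic hpi 0).congr_fun (fun x hx => ?_) measurableSet_Iic
    simp only [abs_of_nonpos (Set.mem_Iic.1 hx)]; congr 1; ring
  · refine (integrableOn_exp_mul_Ioi (neg_lt_zero.2 hpi) 0).congr_fun (fun x hx => ?_) measurableSet_Ioi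
    simp only [abs_of_pos (Set.mem_Ioi.1 hx)]

lemma fourier_exp_neg_abs (k : ℝ) :
    𝓕 (fun x : ℝ => ((Real.pi * Real.exp (-(2 * Real.pi) * |x|) : ℝ) : ℂ)) k =
      (((1 + k ^ 2)⁻¹ : ℝ) : ℂ) := by
  have hpi : (0 : ℝ) < 2 * Real.pi := by positivity
  rw [Real.fourier_real_eq_integral_exp_smul]
  have hint : Integrable fun x : ℝ => Complex.exp ((-2 * Real.pi * x * k : ℝ) * Complex.I) •
      ((Real.pi * Real.exp (-(2 * Real.pi) * |x|) : ℝ) : ℂ) := by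
    simp only [smul_eq_mul]
    refine integrable_exp_neg_abs.bdd_mul (c := 1) (by fun_prop : Continuous _).aestronglyMeasurable
      (Eventually.of_forall fun k => ?_)
    rw [Complex.norm_exp_ofReal_mul_I]
  rw [← intervalIntegral.integral_Iic_add_Ioi (b := (0 : ℝ)) hint.integrableOn hint.integrableOn]
  set a : ℂ := 2 * Real.pi * (1 - k * Complex.I) with ha
  set b : ℂ := -(2 * Real.pi * (1 + k * Complex.I)) with hb
  have e1 : ∫ x : ℝ in Set.Iic 0, Complex.exp ((-2 * Real.pi * x * k : ℝ) * Complex.I) •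
      ((Real.pi * Real.exp (-(2 * Real.pi) * |x|) : ℝ) : ℂ) = Real.pi * (1 / a) := by
    have h := integral_exp_mul_complex_Iic (a := a) (by simp [ha]; positivity) 0
    simp only [Complex.ofReal_zero, mul_zero, Complex.exp_zero] at h
    rw [← h, ← integral_const_mul]
    refine setIntegral_congr_fun measurableSet_Iic fun x hx => ?_
    simp only [abs_of_nonpos (Set.mem_Iic.1 hx), smul_eq_mul]
    rw [Complex.ofReal_mul Real.pi, Complex.ofReal_exp, mul_left_comm, ← Complex.exp_add]
    congr 2
    rw [ha]; push_cast; ring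
  have e2 : ∫ x : ℝ in Set.Ioi 0, Complex.exp ((-2 * Real.pi * x * k : ℝ) * Complex.I) •
      ((Real.pi * Real.exp (-(2 * Real.pi) * |x|) : ℝ) : ℂ) = Real.pi * (-1 / b) := by
    have h := integral_exp_mul_complex_Ioi (a := b) (by simp [hb]; positivity) 0
    simp only [Complex.ofReal_zero, mul_zero, Complex.exp_zero] at h
    rw [← h, ← integral_const_mul]
    refine setIntegral_congr_fun measurableSet_Ioi fun x hx => ?_
    simp only [abs_of_pos (Set.mem_Ioi.1 hx), smul_eq_mul]
    rw [Complex.ofReal_mul Real.pi, Complex.ofReal_exp, mul_left_comm, ← Complex.exp_add]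
    congr 2
    rw [hb]; push_cast; ring
  rw [e1, e2, ha, hb]
  have n1 : (1 : ℂ) - k * Complex.I ≠ 0 := fun h => by simpa using congrArg Complex.re h
  have n2 : (1 : ℂ) + k * Complex.I ≠ 0 := fun h => by simpa using congrArg Complex.re h
  have n3 : (Real.pi : ℂ) ≠ 0 := by exact_mod_cast Real.pi_ne_zero
  have n4 : (1 : ℂ) + (k : ℂ) ^ 2 = (1 - k * Complex.I) * (1 + k * Complex.I) := by
    linear_combination ((k : ℂ) ^ 2) * Complex.I_sq
  push_cast
  rw [n4]
  field_simp
  ring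

lemma integrable_inv_one_add_sq_complex : Integrable fun k : ℝ => (((1 + k ^ 2)⁻¹ : ℝ) : ℂ) :=
  integrable_inv_one_add_sq.ofReal

/-- Obtained by Fourier inversion from the exponential, whose transform is an elementary integral
over two half-lines. -/
lemma fourier_inv_one_add_sq (x : ℝ) :
    𝓕 (fun k : ℝ => (((1 + k ^ 2)⁻¹ : ℝ) : ℂ)) x =
      ((Real.pi * Real.exp (-(2 * Real.pi) * |x|) : ℝ) : ℂ) := by
  have hF : 𝓕 (fun x : ℝ => ((Real.pi * Real.exp (-(2 * Real.pi) * |x|) : ℝ) : ℂ)) =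
      fun k : ℝ => (((1 + k ^ 2)⁻¹ : ℝ) : ℂ) := funext fourier_exp_neg_abs
  have hinv := Continuous.fourierInv_fourier_eq
    (f := fun x : ℝ => ((Real.pi * Real.exp (-(2 * Real.pi) * |x|) : ℝ) : ℂ)) (by fun_prop)
    integrable_exp_neg_abs (by rw [hF]; exact integrable_inv_one_add_sq_complex)
  rw [hF] at hinv
  have := congrFun hinv (-x)
  rw [Real.fourierInv_eq_fourier_neg, neg_neg] at this
  rw [this, abs_neg]

section
variable {u v p q : ℝ} (hu : 0 < u) (hv : 0 < v) (hq : q = 1 - p) (hpq : 0 < p * q)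
include hq hpq hu hv

omit hu hv in
lemma norm_integral_displacementLaw_le {f : ℝ → ℂ} {n : ℤ} {C : ℝ}
    (h : ∀ w : Fin n.natAbs → Bool, ‖f ((n.sign : ℝ) * wordLength u v w)‖ ≤ C) :
    ‖∫ x, f x ∂displacementLaw u v p q n‖ ≤ C := by
  obtain ⟨hp0, hq0⟩ := pos_of_mul_pos hq hpq
  rw [integral_displacementLaw hp0.le hq0.le]
  calc _ ≤ ∑ w : Fin n.natAbs → Bool, wordWeight p q w * C := by
        refine norm_sum_le_of_le _ fun w _ => ?_
        have := wordWeight_nonneg hp0.le hq0.le w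
        rw [norm_smul, Real.norm_of_nonneg this]
        exact mul_le_mul_of_nonneg_left (h w) this
    _ = C := by rw [← Finset.sum_mul, sum_wordWeight hq, one_mul]

/-- The integral is the Abel sum of the averages of `π e^{-2π|x|}` over the displacement laws. As
`|x| ≥ |n| min(u, v)`, it is dominated by a geometric series that does not involve `r`. -/
lemma exists_integral_inv_mul_poisson_le : ∃ C : ℝ, ∀ r : ℝ, 0 < r → r < 1 →
    ∫ k, (1 + k ^ 2)⁻¹ * poisson u v p q r k ≤ C := by
  set c := min u v with hcdef
  have hc : 0 < c := lt_min hu hv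
  set ρ := Real.exp (-(2 * Real.pi) * c) with hρ
  have hρ1 : ρ < 1 := Real.exp_lt_one_iff.2 (by
    have := mul_pos Real.pi_pos hc; linarith)
  have hρ0 : 0 < ρ := Real.exp_pos _
  have hgeo : Summable fun n : ℤ => ρ ^ n.natAbs := by
    have g := summable_geometric_of_lt_one hρ0.le hρ1
    have := g.int_rec (g.mul_left ρ)
    refine this.congr fun n => ?_
    cases n with
    | ofNat n => rfl
    | negSucc n => simp only [Int.natAbs_negSucc, pow_succ]; ring
  refine ⟨∑' n : ℤ, Real.pi * ρ ^ n.natAbs, fun r h0 h1 => ?_⟩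
  have hs := hasSum_integral_poisson (u := u) (v := v) hq hpq h0.le h1
    integrable_inv_one_add_sq_complex
  have e : ∫ k : ℝ, poisson u v p q r k • (((1 + k ^ 2)⁻¹ : ℝ) : ℂ) =
      ((∫ k, (1 + k ^ 2)⁻¹ * poisson u v p q r k : ℝ) : ℂ) := by
    rw [← integral_complex_ofReal]
    congr 1; funext k
    rw [Complex.real_smul]; push_cast; ring
  rw [e] at hs
  have hb : ∀ n : ℤ, ‖(r : ℂ) ^ n.natAbs *
      ∫ x, 𝓕 (fun k : ℝ => (((1 + k ^ 2)⁻¹ : ℝ) : ℂ)) x ∂displacementLaw u v p q n‖ ≤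
      Real.pi * ρ ^ n.natAbs := by
    intro n
    rw [norm_mul, norm_pow, Complex.norm_real, Real.norm_of_nonneg h0.le]
    refine (mul_le_of_le_one_left (norm_nonneg _) (pow_le_one₀ h0.le h1.le)).trans ?_
    refine norm_integral_displacementLaw_le hq hpq fun w => ?_
    rw [fourier_inv_one_add_sq, Complex.norm_real, Real.norm_of_nonneg (by positivity), hρ,
      ← Real.exp_nat_mul]
    have := natAbs_mul_le_abs (min_le_left u v) (min_le_right u v) n w
    have hpi := Real.pi_pos
    exact mul_le_mul_of_nonneg_left (Real.exp_le_exp.2 (by nlinarith)) hpi.le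
  have hle := tsum_of_norm_bounded (hgeo.mul_left Real.pi).hasSum hb
  rw [hs.tsum_eq, Complex.norm_real] at hle
  exact (le_abs_self _).trans hle

end

/-! ### The diffraction measure as Fourier transform, and its Lebesgue decomposition. -/

/-- The diffraction measure of the random tiling. -/
def tilingDiffraction (u v p q d : ℝ) : Measure ℝ :=
  ENNReal.ofReal (d ^ 2) • diracComb (resonances u v) +
    volume.withDensity fun k => ENNReal.ofReal (acDensity u v p q d k)

lemma hasTemperateGrowth_of_integrable {μ : Measure ℝ}
    (h : Integrable (fun x : ℝ => (1 + x ^ 2)⁻¹) μ) : μ.HasTemperateGrowth := by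
  refine ⟨2, h.mono' (by fun_prop : Measurable _).aestronglyMeasurable (Eventually.of_forall fun x => ?_)⟩
  have hx := norm_nonneg x
  rw [Real.norm_of_nonneg (by positivity), Real.rpow_neg (by positivity)]
  norm_cast
  apply inv_anti₀ (by positivity)
  rw [Real.norm_eq_abs] at hx ⊢
  nlinarith [sq_abs x]

lemma isLocallyFiniteMeasure_of_integrable {μ : Measure ℝ}
    (h : Integrable (fun x : ℝ => (1 + x ^ 2)⁻¹) μ) : IsLocallyFiniteMeasure μ := by
  refine ⟨fun x => ⟨Metric.ball x 1, Metric.ball_mem_nhds _ one_pos, ?_⟩⟩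
  refine lt_of_le_of_lt (measure_mono fun y hy => ?_)
    (h.measure_norm_ge_lt_top (ε := (1 + (|x| + 1) ^ 2)⁻¹) (by positivity))
  rw [Metric.mem_ball, Real.dist_eq] at hy
  have h1 : |y| ≤ |x| + 1 := by
    have := abs_sub_abs_le_abs_sub y x
    linarith
  have h2 : y ^ 2 ≤ (|x| + 1) ^ 2 := by rw [← sq_abs y]; gcongr
  show _ ≤ ‖(1 + y ^ 2)⁻¹‖
  rw [Real.norm_of_nonneg (by positivity)]
  gcongr

lemma integrable_sum_measure_of_summable {ι : Type*} {μ : ι → Measure ℝ} {b : ι → ℝ}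
    (hb0 : ∀ i, 0 ≤ b i) (hb : Summable b)
    (h : ∀ i, ∫⁻ x : ℝ, ‖(1 + x ^ 2)⁻¹‖ₑ ∂μ i ≤ ENNReal.ofReal (b i)) :
    Integrable (fun x : ℝ => (1 + x ^ 2)⁻¹) (Measure.sum μ) := by
  refine ⟨(by fun_prop : Measurable _).aestronglyMeasurable, ?_⟩
  rw [HasFiniteIntegral, lintegral_sum_measure]
  refine lt_of_le_of_lt (ENNReal.tsum_le_tsum h) ?_
  rw [← ENNReal.ofReal_tsum_of_nonneg hb0 hb]
  exact ENNReal.ofReal_lt_top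

lemma integrable_diracComb {Z : Set ℝ} (hZ : Summable fun z : Z => (1 + (z : ℝ) ^ 2)⁻¹) :
    Integrable (fun x : ℝ => (1 + x ^ 2)⁻¹) (diracComb Z) := by
  refine integrable_sum_measure_of_summable (fun z => by positivity) hZ fun z => ?_
  rw [lintegral_dirac, Real.enorm_of_nonneg (by positivity)]

/-- Uses the seminorms of orders `0` and `4`, since `(1 + k²)² ≤ 2 + 2k⁴`. -/
lemma norm_schwartz_le (f : 𝓢(ℝ, ℂ)) : ∃ M : ℝ, ∀ k, ‖f k‖ ≤ M * ((1 + k ^ 2)⁻¹) ^ 2 := by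
  obtain ⟨C0, -, h0⟩ := f.decay 0 0
  obtain ⟨C4, -, h4⟩ := f.decay 4 0
  refine ⟨2 * C0 + 2 * C4, fun k => ?_⟩
  have a0 := h0 k
  have a4 := h4 k
  simp only [norm_iteratedFDeriv_zero, pow_zero, one_mul] at a0 a4
  rw [inv_pow, ← div_eq_mul_inv, le_div_iff₀ (by positivity)]
  have e : ‖k‖ ^ 4 = k ^ 4 := by rw [Real.norm_eq_abs, ← abs_pow, abs_of_nonneg (by positivity)]
  rw [e] at a4
  nlinarith [mul_nonneg (norm_nonneg (f k)) (sq_nonneg (k ^ 2 - 1))]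

lemma measure_singleton_diracComb_ne_zero_iff {Z : Set ℝ} (x : ℝ) :
    diracComb Z {x} ≠ 0 ↔ x ∈ Z := by
  rw [diracComb, Measure.sum_apply _ (measurableSet_singleton x)]
  constructor
  · intro h
    by_contra hx
    apply h
    rw [ENNReal.tsum_eq_zero]
    intro z
    rw [Measure.dirac_apply' _ (measurableSet_singleton x), Set.indicator_of_notMem]
    rintro rfl
    exact hx z.2
  · intro hx h
    rw [ENNReal.tsum_eq_zero] at h
    simpa using h ⟨x, hx⟩

lemma ae_mem_diracComb {Z : Set ℝ} (hZ : MeasurableSet Z) : ∀ᵐ x ∂diracComb Z, x ∈ Z := by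
  refine (Measure.ae_sum_iff' (p := fun x => x ∈ Z) hZ).2 fun z => ?_
  exact (ae_dirac_iff (p := fun x => x ∈ Z) hZ).2 z.2

section
variable {u v p q d : ℝ} (hu : 0 < u) (hv : 0 < v) (hq : q = 1 - p) (hpq : 0 < p * q)
  (hd : d = (p * u + q * v)⁻¹)
include hq

lemma acDensity_eq_poissonLimit {k : ℝ} (hk : k ∉ resonances u v) :
    acDensity u v p q d k = d * poissonLimit u v p q k := by
  rw [acDensity, if_neg hk, poissonLimit, one_sub_norm_stepChar_sq u v p q k hq,
    norm_one_sub_stepChar_sq u v p q k hq, mul_assoc 4, mul_div_mul_left _ _ four_ne_zero]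
  ring

include hu in
lemma ae_acDensity_eq : ∀ᵐ k : ℝ, acDensity u v p q d k = d * poissonLimit u v p q k := by
  filter_upwards [(countable_resonances hu v).ae_notMem volume] with k hk
  exact acDensity_eq_poissonLimit hq hk

include hu hv hpq

lemma integrable_tilingAutocorrelation :
    Integrable (fun x : ℝ => (1 + x ^ 2)⁻¹) (tilingAutocorrelation u v p q d) := by
  obtain ⟨hp0, hq0⟩ := pos_of_mul_pos hq hpq
  set c := min u v with hcdef
  have hc : 0 < c := lt_min hu hv
  have hs : Summable fun n : ℤ => (1 + (n * c) ^ 2)⁻¹ := by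
    have h1 := (Real.summable_one_div_int_pow (p := 2)).2 (by norm_num)
    refine Summable.of_norm_bounded_eventually (h1.mul_left (1 / c ^ 2)) ?_
    filter_upwards [(Set.finite_singleton (0 : ℤ)).compl_mem_cofinite] with m hm
    have hm0 : (m : ℝ) ≠ 0 := by exact_mod_cast hm
    rw [Real.norm_of_nonneg (by positivity),
      show 1 / c ^ 2 * (1 / (m : ℝ) ^ 2) = (((m : ℝ) * c) ^ 2)⁻¹ by field_simp]
    apply inv_anti₀ (by positivity)
    linarith
  refine Integrable.smul_measure ?_ ENNReal.ofReal_ne_top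
  refine integrable_sum_measure_of_summable (fun n => by positivity) hs fun n => ?_
  rw [displacementLaw, lintegral_finsetSum_measure]
  simp_rw [lintegral_smul_measure, lintegral_dirac, smul_eq_mul]
  calc _ ≤ ∑ w : Fin n.natAbs → Bool, ENNReal.ofReal (wordWeight p q w) *
        ENNReal.ofReal ((1 + (n * c) ^ 2)⁻¹) := by
        refine Finset.sum_le_sum fun w _ => ?_
        gcongr
        rw [Real.enorm_of_nonneg (by positivity)]
        apply ENNReal.ofReal_le_ofReal
        apply inv_anti₀ (by positivity)
        have := natAbs_mul_le_abs (min_le_left u v) (min_le_right u v) n w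
        rw [← sq_abs (_ * wordLength u v w), ← sq_abs ((n : ℝ) * c), abs_mul (n : ℝ), abs_of_pos hc]
        have e : |(n : ℝ)| = n.natAbs := by rw [Nat.cast_natAbs, Int.cast_abs]
        rw [e]
        gcongr
    _ = _ := by
        rw [← Finset.sum_mul, ← ENNReal.ofReal_sum_of_nonneg
          (fun w _ => wordWeight_nonneg hp0.le hq0.le w), sum_wordWeight hq]
        simp

lemma integrable_acMeasure : Integrable (fun x : ℝ => (1 + x ^ 2)⁻¹)
    (volume.withDensity fun k => ENNReal.ofReal (acDensity u v p q d k)) := by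
  obtain ⟨C, hC⟩ := exists_integral_inv_mul_poisson_le hu hv hq hpq
  have h := integrable_poissonLimit hu hq hpq hC
  have hm : Measurable (acDensity u v p q d) :=
    (contDiff_acDensity u v p q d hu hv hq hpq).continuous.measurable
  by_cases hd : 0 ≤ d
  · rw [integrable_withDensity_iff_integrable_smul' hm.ennreal_ofReal (by simp)]
    refine (h.const_mul d).congr ?_
    filter_upwards [ae_acDensity_eq (v := v) (d := d) hu hq] with k hk
    rw [ENNReal.toReal_ofReal (acDensity_nonneg u v p q d k hd hq hpq), hk, smul_eq_mul]
    ring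
  -- The sign of `d` is not fixed here; for negative `d` the density is nonpositive and
  -- `ENNReal.ofReal` truncates it to zero.
  · have : (fun k => ENNReal.ofReal (acDensity u v p q d k)) = 0 := by
      funext k
      have h1 := acDensity_nonneg u v p q (-d) k (by linarith) hq hpq
      have h2 : acDensity u v p q (-d) k = - acDensity u v p q d k := by
        unfold acDensity; split_ifs <;> ring
      rw [Pi.zero_apply, ENNReal.ofReal_eq_zero]
      linarith
    rw [this]
    simp

lemma integrable_tilingDiffraction :
    Integrable (fun x : ℝ => (1 + x ^ 2)⁻¹) (tilingDiffraction u v p q d) :=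
  ((integrable_diracComb (summable_resonances hu v)).smul_measure ENNReal.ofReal_ne_top).add_measure
    (integrable_acMeasure hu hv hq hpq)

include hd

/-- The Abel sums have two limits as `r → 1`: the undamped sum, by dominated convergence, and the
limit of the Poisson integrals. They must coincide, and multiplication by `d` gives the claim. -/
lemma integral_fourier_tilingAutocorrelation (f : 𝓢(ℝ, ℂ)) :
    ∫ x, (𝓕 f) x ∂tilingAutocorrelation u v p q d = ∫ k, f k ∂tilingDiffraction u v p q d := by
  obtain ⟨hp0, hq0⟩ := pos_of_mul_pos hq hpq
  have hdpos : 0 < d := by rw [hd]; positivity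
  obtain ⟨C, hC⟩ := exists_integral_inv_mul_poisson_le hu hv hq hpq
  obtain ⟨M, hM⟩ := norm_schwartz_le f
  have hγ := hasTemperateGrowth_of_integrable
    (integrable_tilingAutocorrelation (d := d) hu hv hq hpq)
  have hZ := hasTemperateGrowth_of_integrable (integrable_diracComb (summable_resonances hu v))
  have hA := hasTemperateGrowth_of_integrable (integrable_acMeasure (d := d) hu hv hq hpq)
  have hsum : Integrable (𝓕 f : 𝓢(ℝ, ℂ)) (Measure.sum fun n : ℤ => displacementLaw u v p q n) := by
    have := (𝓕 f : 𝓢(ℝ, ℂ)).integrable (μ := tilingAutocorrelation u v p q d)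
    unfold tilingAutocorrelation at this
    rwa [integrable_smul_measure (by simpa using hdpos) ENNReal.ofReal_ne_top] at this
  have ha := hasSum_integral_measure hsum
  obtain ⟨r, h0, h1, hr⟩ := exists_seq_tendsto_one
  have hrC : Tendsto (fun n => (r n : ℂ)) atTop (𝓝 1) := by
    exact_mod_cast (Complex.continuous_ofReal.tendsto 1).comp hr
  have t1 := tendsto_integral_poisson hu hv hq hpq f.continuous hM hC h0 h1 hr
  have t2 : Tendsto (fun j => ∑' n : ℤ, (r j : ℂ) ^ n.natAbs * ∫ x, 𝓕 f x ∂displacementLaw u v p q n)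
      atTop (𝓝 (∑' n : ℤ, ∫ x, 𝓕 f x ∂displacementLaw u v p q n)) := by
    refine tendsto_tsum_of_dominated_convergence ha.summable.norm (fun n => ?_)
      (Eventually.of_forall fun j n => ?_)
    · simpa using (hrC.pow n.natAbs).mul_const (∫ x, 𝓕 f x ∂displacementLaw u v p q n)
    · rw [norm_mul, norm_pow, Complex.norm_real, Real.norm_of_nonneg (h0 j).le]
      exact mul_le_of_le_one_left (norm_nonneg _) (pow_le_one₀ (h0 j).le (h1 j).le)
  have e : ∀ j, ∑' n : ℤ, (r j : ℂ) ^ n.natAbs * ∫ x, 𝓕 f x ∂displacementLaw u v p q n =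
      ∫ k, poisson u v p q (r j) k • f k := fun j => by
    have := (hasSum_integral_poisson (u := u) (v := v) hq hpq (h0 j).le (h1 j) (f.integrable (μ := volume))).tsum_eq
    rw [← this, SchwartzMap.fourier_coe]
  simp_rw [e] at t2
  have hL := tendsto_nhds_unique t2 t1
  have hlhs : ∫ x, (𝓕 f) x ∂tilingAutocorrelation u v p q d =
      d • ((∫ k, poissonLimit u v p q k • f k) +
        ∑' z : resonances u v, (1 / (p * u + q * v) : ℝ) • f z) := by
    rw [tilingAutocorrelation, integral_smul_measure, ← ha.tsum_eq, hL,
      ENNReal.toReal_ofReal hdpos.le]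
  have hm : Measurable (acDensity u v p q d) :=
    (contDiff_acDensity u v p q d hu hv hq hpq).continuous.measurable
  have hZi : Integrable f (Measure.sum fun z : resonances u v => Measure.dirac (z : ℝ)) :=
    f.integrable (μ := diracComb (resonances u v))
  rw [hlhs, tilingDiffraction, integral_add_measure
    ((f.integrable (μ := diracComb (resonances u v))).smul_measure ENNReal.ofReal_ne_top)
    f.integrable, integral_smul_measure, ENNReal.toReal_ofReal (by positivity),
    integral_withDensity_eq_integral_toReal_smul hm.ennreal_ofReal (by simp), diracComb,
    integral_sum_measure hZi]
  simp_rw [integral_dirac]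
  rw [smul_add, add_comm, ← tsum_const_smul'', ← tsum_const_smul'', ← integral_smul]
  congr 1
  · congr 1
    funext z
    -- The peak mass `1 / (pu + qv)` is itself `d`, whence the intensity `d²`.
    rw [smul_smul, one_div, ← hd, sq]
  · refine integral_congr_ae ?_
    filter_upwards [ae_acDensity_eq (v := v) (d := d) hu hq] with k hk
    rw [ENNReal.toReal_ofReal (acDensity_nonneg u v p q d k hdpos.le hq hpq), hk, smul_smul]

theorem isFourierTransform_tiling :
    IsFourierTransform (tilingAutocorrelation u v p q d) (tilingDiffraction u v p q d) := by
  refine ⟨hasTemperateGrowth_of_integrable (integrable_tilingAutocorrelation hu hv hq hpq),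
    hasTemperateGrowth_of_integrable (integrable_tilingDiffraction hu hv hq hpq), ?_⟩
  ext f
  simpa using integral_fourier_tilingAutocorrelation hu hv hq hpq hd f

theorem purePointPart_tilingDiffraction : purePointPart (tilingDiffraction u v p q d) =
    ENNReal.ofReal (d ^ 2) • diracComb (resonances u v) := by
  obtain ⟨hp0, hq0⟩ := pos_of_mul_pos hq hpq
  have hdpos : 0 < d := by rw [hd]; positivity
  have hc := countable_resonances hu v
  have hac := withDensity_absolutelyContinuous (volume : Measure ℝ)
    fun k => ENNReal.ofReal (acDensity u v p q d k)
  have hset : {x | tilingDiffraction u v p q d {x} ≠ 0} = resonances u v := by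
    ext x
    have h0 : (volume.withDensity fun k => ENNReal.ofReal (acDensity u v p q d k)) {x} = 0 :=
      hac (by simp)
    rw [Set.mem_ofPred_eq, tilingDiffraction, Measure.add_apply, h0, add_zero, Measure.smul_apply,
      smul_eq_mul, ← measure_singleton_diracComb_ne_zero_iff (Z := resonances u v), ne_eq, mul_eq_zero,
      not_or, and_iff_right]
    simpa using hdpos.ne'
  rw [purePointPart, hset, tilingDiffraction, Measure.restrict_add, Measure.restrict_smul,
    Measure.restrict_eq_self_of_ae_mem (ae_mem_diracComb hc.measurableSet),
    Measure.restrict_eq_zero.2 (hac (hc.measure_zero _)), add_zero]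

omit hd in
-- The comb lives on a countable, hence Lebesgue-null, set, so uniqueness of the Lebesgue
-- decomposition applies.
theorem acPart_tilingDiffraction : acPart (tilingDiffraction u v p q d) =
    volume.withDensity fun k => ENNReal.ofReal (acDensity u v p q d k) := by
  have hc := countable_resonances hu v
  have hm : Measurable (acDensity u v p q d) :=
    (contDiff_acDensity u v p q d hu hv hq hpq).continuous.measurable
  refine (Measure.eq_withDensity_rnDeriv hm.ennreal_ofReal
    (s := ENNReal.ofReal (d ^ 2) • diracComb (resonances u v)) ?_ rfl).symm
  refine ⟨(resonances u v)ᶜ, hc.measurableSet.compl, ?_, by rw [compl_compl]; exact hc.measure_zero volume⟩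
  have := ae_mem_diracComb hc.measurableSet
  rw [ae_iff] at this
  rw [Measure.smul_apply]
  exact (congrArg _ this).trans (smul_zero _)

end

/-! ### Almost sure word frequencies. -/

open Classical in
/-- Indicator of the occurrence of the word `w` at position `j` of the sequence `b`. -/
def wordIndicator (b : ℤ → Bool) {n : ℕ} (w : Fin n → Bool) (j : ℤ) : ℝ :=
  if (fun i : Fin n => b (j + i)) = w then 1 else 0

/-- Every word has, in both directions, the frequency it has for independent letters. -/
def HasWordFrequencies (p q : ℝ) (b : ℤ → Bool) : Prop :=
  ∀ (n : ℕ) (w : Fin n → Bool),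
    Tendsto (fun N : ℤ => leftEndpoint 0 (wordIndicator b w) N / N) atTop (𝓝 (wordWeight p q w)) ∧
    Tendsto (fun N : ℤ => leftEndpoint 0 (wordIndicator b w) N / N) atBot (𝓝 (wordWeight p q w))

lemma abs_wordIndicator_le (b : ℤ → Bool) {n : ℕ} (w : Fin n → Bool) (j : ℤ) :
    |wordIndicator b w j| ≤ 1 := by
  unfold wordIndicator; split_ifs <;> simp

lemma leftEndpoint_zero (t : ℝ) (x : ℤ → ℝ) : leftEndpoint t x 0 = t := by simp [leftEndpoint]

lemma leftEndpoint_add_one (t : ℝ) (x : ℤ → ℝ) (n : ℤ) :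
    leftEndpoint t x (n + 1) = leftEndpoint t x n + x n := by
  unfold leftEndpoint
  rcases le_or_gt 0 n with h | h
  · have e1 : Finset.Ico 0 (n + 1) = insert n (Finset.Ico 0 n) := by
      ext i; simp only [Finset.mem_Ico, Finset.mem_insert]; omega
    have e2 : Finset.Ico (n + 1) 0 = ∅ := Finset.Ico_eq_empty (by omega)
    have e3 : Finset.Ico n 0 = ∅ := Finset.Ico_eq_empty (by omega)
    rw [e1, e2, e3, Finset.sum_insert (by simp)]
    simp; ring
  · have e1 : Finset.Ico n 0 = insert n (Finset.Ico (n + 1) 0) := by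
      ext i; simp only [Finset.mem_Ico, Finset.mem_insert]; omega
    have e2 : Finset.Ico 0 (n + 1) = ∅ := Finset.Ico_eq_empty (by omega)
    have e3 : Finset.Ico 0 n = ∅ := Finset.Ico_eq_empty (by omega)
    rw [e1, e2, e3, Finset.sum_insert (by simp)]
    ring

lemma leftEndpoint_natCast (x : ℤ → ℝ) (N : ℕ) :
    leftEndpoint 0 x N = ∑ j ∈ Finset.range N, x j := by
  induction N with
  | zero => simp [leftEndpoint_zero]
  | succ N ih => rw [Nat.cast_succ, leftEndpoint_add_one, ih, Finset.sum_range_succ]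

lemma leftEndpoint_neg_natCast (x : ℤ → ℝ) (N : ℕ) :
    leftEndpoint 0 x (-N) = -∑ j ∈ Finset.range N, x (-(j + 1)) := by
  induction N with
  | zero => simp [leftEndpoint_zero]
  | succ N ih =>
    have h := leftEndpoint_add_one 0 x (-((N : ℤ) + 1))
    rw [show -((N : ℤ) + 1) + 1 = -N by ring, ih] at h
    rw [Nat.cast_succ, Finset.sum_range_succ]
    linarith

lemma sum_range_mul_eq (y : ℕ → ℝ) (n M : ℕ) : ∑ j ∈ Finset.range (M * n), y j =
    ∑ r ∈ Finset.range n, ∑ m ∈ Finset.range M, y (m * n + r) := by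
  induction M with
  | zero => simp
  | succ M ih =>
    rw [Nat.succ_mul, Finset.sum_range_add, ih, ← Finset.sum_add_distrib]
    simp_rw [Finset.sum_range_succ]

/-- Averages converge if they converge along each residue class. -/
lemma tendsto_average_of_residues {y : ℕ → ℝ} (hy : ∀ j, |y j| ≤ 1) {n : ℕ} (hn : 0 < n) {μ : ℝ}
    (h : ∀ r < n, Tendsto (fun M : ℕ => (∑ m ∈ Finset.range M, y (m * n + r)) / M) atTop (𝓝 μ)) :
    Tendsto (fun N : ℕ => (∑ j ∈ Finset.range N, y j) / N) atTop (𝓝 μ) := by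
  have hn' : (n : ℝ) ≠ 0 := by positivity
  have hT : Tendsto (fun M : ℕ => (∑ j ∈ Finset.range (M * n), y j) / M) atTop (𝓝 (n * μ)) := by
    have := tendsto_finsetSum (Finset.range n) fun r hr => h r (Finset.mem_range.1 hr)
    simp only [Finset.sum_const, Finset.card_range, nsmul_eq_mul] at this
    refine this.congr fun M => ?_
    rw [sum_range_mul_eq, Finset.sum_div]
  have hdiv : Tendsto (fun N : ℕ => N / n) atTop atTop := Nat.tendsto_div_const_atTop hn.ne'
  have hbd : ∀ f : ℕ → ℝ, (∀ N, |f N| ≤ n) → Tendsto (fun N : ℕ => f N / N) atTop (𝓝 0) :=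
    fun f hf => tendsto_bdd_div_atTop_nhds_zero (b := -n) (B := n)
      (Eventually.of_forall fun N => (abs_le.1 (hf N)).1)
      (Eventually.of_forall fun N => (abs_le.1 (hf N)).2) tendsto_natCast_atTop_atTop
  have hmod := hbd (fun N => ((N % n : ℕ) : ℝ)) fun N => by
    rw [Nat.abs_cast]; exact_mod_cast (Nat.mod_lt N hn).le
  -- The incomplete last block has fewer than `n` terms, each at most `1` in modulus.
  have herr := hbd (fun N => ∑ j ∈ Finset.range (N % n), y (N / n * n + j)) fun N => by
    refine (Finset.abs_sum_le_sum_abs _ _).trans ((Finset.sum_le_sum fun j _ => hy _).trans ?_)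
    simp only [Finset.sum_const, Finset.card_range, nsmul_eq_mul, mul_one]
    exact_mod_cast (Nat.mod_lt N hn).le
  have hfrac : Tendsto (fun N : ℕ => ((N / n : ℕ) : ℝ) / N) atTop (𝓝 (1 / n)) := by
    have := (hmod.const_sub 1).div_const (n : ℝ)
    rw [sub_zero] at this
    refine this.congr' ?_
    filter_upwards [eventually_gt_atTop 0] with N hN
    have hN' : (N : ℝ) ≠ 0 := by positivity
    have := Nat.div_add_mod N n
    have : (n : ℝ) * (N / n : ℕ) + (N % n : ℕ) = N := by exact_mod_cast this
    field_simp
    linarith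
  have := ((hT.comp hdiv).mul hfrac).add herr
  rw [show (n : ℝ) * μ * (1 / n) + 0 = μ by field_simp; ring] at this
  refine this.congr' ?_
  filter_upwards [eventually_ge_atTop n] with N hN
  have hpos : ((N / n : ℕ) : ℝ) ≠ 0 := by
    have : 0 < N / n := Nat.div_pos hN hn
    positivity
  have e : N = N / n * n + N % n := (Nat.div_add_mod' N n).symm
  have e2 : ∑ j ∈ Finset.range N, y j = ∑ j ∈ Finset.range (N / n * n), y j +
      ∑ j ∈ Finset.range (N % n), y (N / n * n + j) := by
    conv_lhs => rw [e]
    rw [Finset.sum_range_add]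
  simp only [Function.comp]
  rw [e2, div_mul_div_cancel₀ hpos, add_div]

section
variable {Ω : Type*} [MeasurableSpace Ω] {P : Measure Ω} [IsProbabilityMeasure P] {p q : ℝ}
  {X : ℤ → Ω → Bool} (hp : 0 ≤ p) (hq0 : 0 ≤ q) (hq : q = 1 - p)
  (hXm : ∀ i, Measurable (X i)) (hXi : iIndepFun X P)
  (hXp : ∀ i, P {σ | X i σ = true} = ENNReal.ofReal p)
include hp hq hXm hXp

omit hq0 in
lemma map_letter_singleton (i : ℤ) (b : Bool) :
    P.map (X i) {b} = ENNReal.ofReal (if b then p else q) := by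
  rw [Measure.map_apply (hXm i) (measurableSet_singleton b)]
  cases b with
  | true => exact hXp i
  | false =>
    have : X i ⁻¹' {false} = {σ | X i σ = true}ᶜ := by ext σ; simp
    have hm : MeasurableSet {σ | X i σ = true} := hXm i (measurableSet_singleton true)
    rw [this, prob_compl_eq_one_sub hm, hXp, hq]
    simp [ENNReal.ofReal_sub _ hp]

omit hq0 in
lemma map_letter_eq (i j : ℤ) : P.map (X i) = P.map (X j) := by
  refine Measure.ext_of_singleton fun b => ?_
  rw [map_letter_singleton hp hq hXm hXp, map_letter_singleton hp hq hXm hXp]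

include hXi hq0

/-- Positions at mutual distance at least `n` have disjoint windows, so the indicators are
independent and identically distributed, and the strong law applies. -/
lemma ae_tendsto_average_wordIndicator {n : ℕ} (w : Fin n → Bool) (e : ℕ → ℤ)
    (he : ∀ m m', m ≠ m' → (n : ℤ) ≤ |e m - e m'|) :
    ∀ᵐ σ ∂P, Tendsto (fun M : ℕ => (∑ m ∈ Finset.range M, wordIndicator (fun i => X i σ) w (e m)) / M)
      atTop (𝓝 (wordWeight p q w)) := by
  classical
  set F : (Fin n → Bool) → ℝ := fun y => if y = w then 1 else 0 with hF
  have hFm : Measurable F := .of_discrete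
  set T : ℕ → Ω → (Fin n → Bool) := fun m σ i => X (e m + i) σ with hT
  have hTm : ∀ m, Measurable (T m) := fun m => measurable_pi_lambda _ fun i => hXm _
  have hY : ∀ m σ, wordIndicator (fun i => X i σ) w (e m) = (F ∘ T m) σ := fun m σ => by
    simp only [wordIndicator, hF, hT, Function.comp]
  have hmap : ∀ m, P.map (T m) = Measure.pi fun _ : Fin n => P.map (X 0) := fun m => by
    have hinj : Function.Injective fun i : Fin n => e m + (i : ℤ) := fun a b hab => by
      simpa [Fin.ext_iff] using hab
    have := (hXi.precomp hinj).map_fun_eq_pi_map fun i => (hXm _).aemeasurable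
    rw [hT]
    refine this.trans ?_
    congr 1
    funext i
    exact map_letter_eq hp hq hXm hXp _ _
  have hident : ∀ m, IdentDistrib (F ∘ T m) (F ∘ T 0) P P := fun m =>
    IdentDistrib.comp ⟨(hTm m).aemeasurable, (hTm 0).aemeasurable, by rw [hmap, hmap]⟩ hFm
  have hind : Pairwise (Function.onFun (· ⟂ᵢ[P] ·) fun m => F ∘ T m) := by
    intro m m' hmm
    set S : ℕ → Finset ℤ := fun m => Finset.univ.image fun i : Fin n => e m + (i : ℤ) with hS
    have hmem : ∀ m (i : Fin n), e m + (i : ℤ) ∈ S m := fun m i =>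
      Finset.mem_image_of_mem _ (Finset.mem_univ i)
    have hdisj : Disjoint (S m) (S m') := by
      rw [Finset.disjoint_left]
      intro a ha ha'
      simp only [hS, Finset.mem_image, Finset.mem_univ, true_and] at ha ha'
      obtain ⟨i, hi⟩ := ha
      obtain ⟨i', hi'⟩ := ha'
      have h1 := he m m' hmm
      have h2 := i.2
      have h3 := i'.2
      rw [le_abs] at h1
      omega
    have h1 := hXi.indepFun_finset (S m) (S m') hdisj hXm
    have h2 : ∀ m, F ∘ T m = (fun y : S m → Bool => F fun i => y ⟨e m + i, hmem m i⟩) ∘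
        fun σ (i : S m) => X i σ := fun m => rfl
    show IndepFun (F ∘ T m) (F ∘ T m') P
    rw [h2 m, h2 m']
    exact h1.comp .of_discrete .of_discrete
  have hint : Integrable (F ∘ T 0) P := by
    refine (integrable_const (1 : ℝ)).mono' (hFm.comp (hTm 0)).aestronglyMeasurable
      (Eventually.of_forall fun σ => ?_)
    simp only [hF, Function.comp]; split_ifs <;> simp
  have hexp : ∫ σ, (F ∘ T 0) σ ∂P = wordWeight p q w := by
    have h1 : ∫ σ, (F ∘ T 0) σ ∂P = ∫ y, F y ∂P.map (T 0) :=
      (integral_map (hTm 0).aemeasurable hFm.aestronglyMeasurable).symm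
    have h2 : F = Set.indicator {w} 1 := by
      funext y; simp [hF, Set.indicator_apply]
    rw [h1, h2, integral_indicator_one (measurableSet_singleton w), hmap, measureReal_def,
      Measure.pi_singleton]
    simp_rw [map_letter_singleton hp hq hXm hXp]
    rw [ENNReal.toReal_prod, wordWeight]
    refine Finset.prod_congr rfl fun i _ => ENNReal.toReal_ofReal ?_
    split_ifs <;> assumption
  have := strong_law_ae_real (fun m => F ∘ T m) hint hind hident
  rw [hexp] at this
  simpa only [hY] using this

/-- Indicators at neighbouring positions are dependent, so the positions are split into residue
classes on which the windows are disjoint. The words, lengths and residues are countably many, hence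
one null set suffices. -/
theorem ae_hasWordFrequencies : ∀ᵐ σ ∂P, HasWordFrequencies p q fun i => X i σ := by
  unfold HasWordFrequencies
  rw [ae_all_iff]; intro n
  rw [ae_all_iff]; intro w
  -- The modulus is `n + 1` rather than `n`, so that it stays positive for the empty word.
  have h1 : ∀ᵐ σ ∂P, ∀ r : ℕ, Tendsto (fun M : ℕ => (∑ m ∈ Finset.range M,
      wordIndicator (fun i => X i σ) w ((m * (n + 1) + r : ℕ) : ℤ)) / M)
      atTop (𝓝 (wordWeight p q w)) := by
    rw [ae_all_iff]; intro r
    refine ae_tendsto_average_wordIndicator hp hq0 hq hXm hXi hXp w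
      (fun m => ((m * (n + 1) + r : ℕ) : ℤ)) fun m m' hm => ?_
    have : (1 : ℤ) ≤ |(m : ℤ) - m'| := Int.one_le_abs (by omega)
    push_cast
    rw [show (m : ℤ) * (n + 1) + r - (m' * (n + 1) + r) = (m - m') * (n + 1) by ring, abs_mul,
      abs_of_pos (by positivity : (0 : ℤ) < n + 1)]
    nlinarith
  have h2 : ∀ᵐ σ ∂P, ∀ r : ℕ, Tendsto (fun M : ℕ => (∑ m ∈ Finset.range M,
      wordIndicator (fun i => X i σ) w (-(((m * (n + 1) + r : ℕ) : ℤ) + 1))) / M)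
      atTop (𝓝 (wordWeight p q w)) := by
    rw [ae_all_iff]; intro r
    refine ae_tendsto_average_wordIndicator hp hq0 hq hXm hXi hXp w
      (fun m => -(((m * (n + 1) + r : ℕ) : ℤ) + 1)) fun m m' hm => ?_
    have : (1 : ℤ) ≤ |(m' : ℤ) - m| := Int.one_le_abs (by omega)
    push_cast
    rw [show -((m : ℤ) * (n + 1) + r + 1) - -(m' * (n + 1) + r + 1) = (m' - m) * (n + 1) by ring,
      abs_mul, abs_of_pos (by positivity : (0 : ℤ) < n + 1)]
    nlinarith
  filter_upwards [h1, h2] with σ g1 g2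
  constructor
  · have t := (tendsto_average_of_residues (y := fun j => wordIndicator (fun i => X i σ) w j)
      (fun j => abs_wordIndicator_le _ _ _) n.succ_pos fun r _ => g1 r).comp
      (tendsto_atTop_atTop.2 fun N => ⟨(N : ℤ), fun M hM => by
        show N ≤ M.toNat
        omega⟩ : Tendsto Int.toNat atTop atTop)
    refine t.congr' ?_
    filter_upwards [eventually_ge_atTop 0] with N hN
    lift N to ℕ using hN
    simp only [Function.comp, Int.toNat_natCast, leftEndpoint_natCast, Int.cast_natCast]
  · have t := (tendsto_average_of_residues (y := fun j => wordIndicator (fun i => X i σ) w (-((j : ℤ) + 1)))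
      (fun j => abs_wordIndicator_le _ _ _) n.succ_pos fun r _ => g2 r).comp
      (tendsto_atBot_atTop.2 fun N => ⟨-(N : ℤ), fun M hM => by
        show N ≤ (-M).toNat
        omega⟩ : Tendsto (fun M : ℤ => (-M).toNat) atBot atTop)
    refine t.congr' ?_
    filter_upwards [eventually_le_atBot 0] with N hN
    obtain ⟨k, rfl⟩ : ∃ k : ℕ, N = -k := ⟨(-N).toNat, by omega⟩
    simp only [Function.comp, neg_neg, Int.toNat_natCast, leftEndpoint_neg_natCast, Int.cast_neg,
      Int.cast_natCast, neg_div_neg_eq]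

end

/-! ### The points of the tiling, their growth and their density. -/

/-- The left endpoints of the tiling coded by `b`. -/
def tilingPoint (u v t₀ : ℝ) (b : ℤ → Bool) : ℤ → ℝ :=
  leftEndpoint t₀ fun i => tileLength u v (b i)

lemma sum_Ico_eq_leftEndpoint_sub (t : ℝ) (y : ℤ → ℝ) {A B : ℤ} (h : A ≤ B) :
    ∑ j ∈ Finset.Ico A B, y j = leftEndpoint t y B - leftEndpoint t y A := by
  induction B, h using Int.leInduction with
  | base => simp
  | succ B h ih =>
    have e : Finset.Ico A (B + 1) = insert B (Finset.Ico A B) := by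
      ext i; simp only [Finset.mem_Ico, Finset.mem_insert]; omega
    rw [e, Finset.sum_insert (by simp), ih, leftEndpoint_add_one]
    ring

lemma leftEndpoint_sum {ι : Type*} (s : Finset ι) (t : ℝ) (y : ι → ℤ → ℝ) (c : ι → ℝ) (N : ℤ) :
    leftEndpoint t (fun j => ∑ i ∈ s, c i * y i j) N = t + ∑ i ∈ s, c i * leftEndpoint 0 (y i) N := by
  simp only [leftEndpoint, zero_add, mul_sub, Finset.sum_sub_distrib, Finset.mul_sum]
  rw [Finset.sum_comm, Finset.sum_comm (s := Finset.Ico N 0)]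
  ring

section
variable {u v t₀ : ℝ} {b : ℤ → Bool}

lemma tilingPoint_add_one (n : ℤ) : tilingPoint u v t₀ b (n + 1) =
    tilingPoint u v t₀ b n + tileLength u v (b n) := leftEndpoint_add_one _ _ _

lemma tileLength_pos (hu : 0 < u) (hv : 0 < v) (c : Bool) : 0 < tileLength u v c := by
  unfold tileLength; split_ifs <;> assumption

lemma tileLength_le (c : Bool) : tileLength u v c ≤ max u v := by
  unfold tileLength; split_ifs <;> simp

lemma strictMono_tilingPoint (hu : 0 < u) (hv : 0 < v) : StrictMono (tilingPoint u v t₀ b) :=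
  strictMono_int_of_lt_succ fun n => by
    rw [tilingPoint_add_one]; linarith [tileLength_pos hu hv (b n)]

lemma tilingPoint_add_natCast (j : ℤ) (n : ℕ) : tilingPoint u v t₀ b (j + n) =
    tilingPoint u v t₀ b j + wordLength u v fun i : Fin n => b (j + i) := by
  induction n with
  | zero => simp [wordLength]
  | succ n ih =>
    rw [Nat.cast_succ, ← add_assoc, tilingPoint_add_one, ih, wordLength, wordLength,
      Fin.sum_univ_castSucc]
    simp [add_assoc]

lemma natCast_mul_min_le (j : ℤ) (n : ℕ) :
    n * min u v ≤ tilingPoint u v t₀ b (j + n) - tilingPoint u v t₀ b j := by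
  rw [tilingPoint_add_natCast, add_sub_cancel_left]
  exact le_wordLength (min_le_left u v) (min_le_right u v) _

lemma abs_sub_mul_min_le (i j : ℤ) :
    |(i : ℝ) - j| * min u v ≤ |tilingPoint u v t₀ b i - tilingPoint u v t₀ b j| := by
  wlog h : j ≤ i generalizing i j with H
  · rw [abs_sub_comm, abs_sub_comm (tilingPoint u v t₀ b i)]
    exact H j i (by omega)
  · obtain ⟨n, rfl⟩ : ∃ n : ℕ, i = j + n := ⟨(i - j).toNat, by omega⟩
    have := natCast_mul_min_le (u := u) (v := v) (t₀ := t₀) (b := b) j n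
    refine le_trans ?_ (le_abs_self _)
    have e : |((j + n : ℤ) : ℝ) - j| = n := by
      push_cast
      rw [add_sub_cancel_left, Nat.abs_cast]
    rwa [e]

open Classical in
-- Exactly one word occurs at each position. Any function of a window thus becomes a combination of
-- indicators, whose averages are known.
lemma sum_wordIndicator_smul {E : Type*} [AddCommGroup E] [Module ℝ E] {n : ℕ}
    (G : (Fin n → Bool) → E) (j : ℤ) :
    ∑ w, wordIndicator b w j • G w = G fun i => b (j + i) := by
  rw [Finset.sum_eq_single fun i : Fin n => b (j + i)]
  · simp [wordIndicator]
  · intro w _ hw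
    simp [wordIndicator, hw.symm]
  · simp

end

section
variable {u v p q t₀ : ℝ} (hu : 0 < u) (hv : 0 < v) (hq : q = 1 - p) (hpq : 0 < p * q)
  {b : ℤ → Bool} (hb : HasWordFrequencies p q b)
include hb

/-- Only the words of length one are needed: the mean tile length is the average of the two lengths
weighted by letter frequencies. -/
lemma tendsto_tilingPoint_div {l : Filter ℤ} (hl : l = atTop ∨ l = atBot) :
    Tendsto (fun N : ℤ => tilingPoint u v t₀ b N / N) l (𝓝 (p * u + q * v)) := by
  have hlen : (fun i => tileLength u v (b i)) =
      fun j => ∑ w : Fin 1 → Bool, wordLength u v w * wordIndicator b w j := by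
    funext j
    have := sum_wordIndicator_smul (b := b) (fun w : Fin 1 → Bool => wordLength u v w) j
    simp only [smul_eq_mul] at this
    simp_rw [mul_comm (wordLength u v _), this]
    simp [wordLength]
  have hinv : Tendsto (fun N : ℤ => t₀ / N) l (𝓝 0) := by
    rcases hl with rfl | rfl
    · exact tendsto_const_nhds.div_atTop tendsto_intCast_atTop_atTop
    · exact tendsto_const_nhds.div_atBot (tendsto_intCast_atBot_iff.2 tendsto_id)
  have hw : ∀ w : Fin 1 → Bool, Tendsto (fun N : ℤ => leftEndpoint 0 (wordIndicator b w) N / N) l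
      (𝓝 (wordWeight p q w)) := fun w => by
    rcases hl with rfl | rfl
    exacts [(hb 1 w).1, (hb 1 w).2]
  have hs := hinv.add (tendsto_finsetSum Finset.univ fun w _ => (hw w).const_mul (wordLength u v w))
  have hval : 0 + ∑ w : Fin 1 → Bool, wordLength u v w * wordWeight p q w = p * u + q * v := by
    rw [zero_add, ← (Equiv.funUnique (Fin 1) Bool).symm.sum_comp]
    simp [wordLength, wordWeight, tileLength, mul_comm]
  rw [hval] at hs
  refine hs.congr fun N => ?_
  rw [tilingPoint, hlen, leftEndpoint_sum, add_div, Finset.sum_div]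
  simp only [mul_div_assoc]

include hu hv hq hpq

lemma tendsto_tilingPoint_atTop : Tendsto (tilingPoint u v t₀ b) atTop atTop := by
  obtain ⟨hp0, hq0⟩ := pos_of_mul_pos hq hpq
  have h := tendsto_tilingPoint_div (u := u) (v := v) (t₀ := t₀) hb (Or.inl rfl)
  have h2 := h.pos_mul_atTop (by positivity) tendsto_intCast_atTop_atTop
  refine h2.congr' ?_
  filter_upwards [eventually_gt_atTop 0] with N hN
  have : (N : ℝ) ≠ 0 := by exact_mod_cast hN.ne'
  field_simp

lemma tendsto_tilingPoint_atBot : Tendsto (tilingPoint u v t₀ b) atBot atBot := by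
  obtain ⟨hp0, hq0⟩ := pos_of_mul_pos hq hpq
  have h := tendsto_tilingPoint_div (u := u) (v := v) (t₀ := t₀) hb (Or.inr rfl)
  have h2 := h.pos_mul_atBot (by positivity) (tendsto_intCast_atBot_iff.2 tendsto_id)
  refine h2.congr' ?_
  filter_upwards [eventually_lt_atBot 0] with N hN
  have : (N : ℝ) ≠ 0 := by exact_mod_cast hN.ne
  exact div_mul_cancel₀ _ this

/-- The indices of the points in `[-R, R]` form an interval, with asymptotically linear ends. -/
lemma exists_index_interval : ∃ A B : ℝ → ℤ,
    (∀ R n, |tilingPoint u v t₀ b n| ≤ R ↔ A R ≤ n ∧ n < B R) ∧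
    Tendsto A atTop atBot ∧ Tendsto B atTop atTop ∧
    Tendsto (fun R => (A R : ℝ) / R) atTop (𝓝 (-(p * u + q * v)⁻¹)) ∧
    Tendsto (fun R => (B R : ℝ) / R) atTop (𝓝 (p * u + q * v)⁻¹) := by
  obtain ⟨hp0, hq0⟩ := pos_of_mul_pos hq hpq
  set x := tilingPoint u v t₀ b with hx
  set m := p * u + q * v with hm
  have hm0 : 0 < m := by positivity
  have hmono : StrictMono x := strictMono_tilingPoint hu hv
  have htop := tendsto_tilingPoint_atTop (t₀ := t₀) hu hv hq hpq hb
  have hbot := tendsto_tilingPoint_atBot (t₀ := t₀) hu hv hq hpq hb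
  have hBex : ∀ R : ℝ, ∃ B : ℤ, ∀ n, x n ≤ R ↔ n < B := by
    intro R
    obtain ⟨k1, hk1⟩ := (htop.eventually (eventually_gt_atTop R)).exists
    obtain ⟨k2, hk2⟩ := (hbot.eventually (eventually_le_atBot R)).exists
    obtain ⟨B, hB1, hB2⟩ := Int.exists_greatest_of_bdd (P := fun n => x n ≤ R)
      ⟨k1, fun z hz => (hmono.lt_iff_lt.1 (lt_of_le_of_lt hz hk1)).le⟩ ⟨k2, hk2⟩
    refine ⟨B + 1, fun n => ⟨fun h => by have := hB2 n h; omega, fun h => ?_⟩⟩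
    exact (hmono.monotone (by omega)).trans hB1
  have hAex : ∀ R : ℝ, ∃ A : ℤ, ∀ n, -R ≤ x n ↔ A ≤ n := by
    intro R
    obtain ⟨k1, hk1⟩ := (htop.eventually (eventually_ge_atTop (-R))).exists
    obtain ⟨k2, hk2⟩ := (hbot.eventually (eventually_lt_atBot (-R))).exists
    obtain ⟨A, hA1, hA2⟩ := Int.exists_least_of_bdd (P := fun n => -R ≤ x n)
      ⟨k2, fun z hz => (hmono.lt_iff_lt.1 (lt_of_lt_of_le hk2 hz)).le⟩ ⟨k1, hk1⟩
    exact ⟨A, fun n => ⟨hA2 n, fun h => hA1.trans (hmono.monotone h)⟩⟩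
  choose B hB using hBex
  choose A hA using hAex
  have hBtop : Tendsto B atTop atTop := tendsto_atTop.2 fun k => by
    filter_upwards [eventually_ge_atTop (x k)] with R hR
    exact ((hB R k).1 hR).le
  have hAbot : Tendsto A atTop atBot := tendsto_atBot.2 fun k => by
    filter_upwards [eventually_ge_atTop (-x k)] with R hR
    exact (hA R k).1 (by linarith)
  have hstep : ∀ n, x n ≤ x (n - 1) + max u v := fun n => by
    have := tilingPoint_add_one (u := u) (v := v) (t₀ := t₀) (b := b) (n - 1)
    rw [sub_add_cancel] at this
    rw [hx, this]
    linarith [tileLength_le (u := u) (v := v) (b (n - 1))]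
  have hBR : ∀ R, R < x (B R) ∧ x (B R) ≤ R + max u v := fun R => by
    have h1 : ¬ x (B R) ≤ R := fun h => lt_irrefl _ ((hB R _).1 h)
    have h2 : x (B R - 1) ≤ R := (hB R _).2 (by omega)
    exact ⟨not_le.1 h1, by linarith [hstep (B R)]⟩
  have hAR : ∀ R, -R ≤ x (A R) ∧ x (A R) ≤ -R + max u v := fun R => by
    have h1 : -R ≤ x (A R) := (hA R _).2 le_rfl
    have h2 : ¬ -R ≤ x (A R - 1) := fun h => by have := (hA R _).1 h; omega
    exact ⟨h1, by linarith [hstep (A R), not_le.1 h2]⟩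
  -- If `x (N R)` stays within a tile of `sR` and `x N / N → m`, then `N R / R → s/m`; used with `s
  -- = -1` for the lower end and `s = 1` for the upper one.
  have hlim : ∀ (N : ℝ → ℤ) (s : ℝ), s ≠ 0 → (∀ R, |x (N R) - s * R| ≤ max u v) →
      Tendsto (fun R => x (N R) / N R) atTop (𝓝 m) → (∀ᶠ R in atTop, (N R : ℝ) ≠ 0) →
      Tendsto (fun R => (N R : ℝ) / R) atTop (𝓝 (s * m⁻¹)) := by
    intro N s hs h1 h2 h3
    have e0 : Tendsto (fun R => (x (N R) - s * R) / R) atTop (𝓝 0) :=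
      tendsto_bdd_div_atTop_nhds_zero (b := -max u v) (B := max u v)
        (Eventually.of_forall fun R => (abs_le.1 (h1 R)).1)
        (Eventually.of_forall fun R => (abs_le.1 (h1 R)).2) tendsto_id
    have e1 : Tendsto (fun R => x (N R) / R) atTop (𝓝 s) := by
      have := e0.add_const s
      rw [zero_add] at this
      refine this.congr' ?_
      filter_upwards [eventually_gt_atTop 0] with R hR
      field_simp; ring
    have e2 := e1.mul (h2.inv₀ hm0.ne')
    refine e2.congr' ?_
    have e3 : ∀ᶠ R in atTop, x (N R) / R ≠ 0 := e1.eventually_ne hs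
    filter_upwards [h3, e3, eventually_gt_atTop 0] with R hR hx0 hR0
    have : x (N R) ≠ 0 := fun h => hx0 (by rw [h, zero_div])
    field_simp
  refine ⟨A, B, fun R n => by rw [abs_le, hA, hB], hAbot, hBtop, ?_, ?_⟩
  · have := hlim A (-1) (by norm_num) (fun R => by
        have := hAR R
        rw [abs_le]; constructor <;> linarith [hu, le_max_left u v])
      ((tendsto_tilingPoint_div hb (Or.inr rfl)).comp hAbot)
      ((hAbot.eventually (eventually_lt_atBot 0)).mono fun R h => by exact_mod_cast h.ne)
    simpa using this
  · have := hlim B 1 (by norm_num) (fun R => by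
        have := hBR R
        rw [abs_le]; constructor <;> linarith [hu, le_max_left u v])
      ((tendsto_tilingPoint_div hb (Or.inl rfl)).comp hBtop)
      ((hBtop.eventually (eventually_gt_atTop 0)).mono fun R h => by exact_mod_cast h.ne')
    simpa using this

theorem hasNaturalDensity_tilingPoints :
    HasNaturalDensity (tilingPoints u v t₀ b) (p * u + q * v)⁻¹ := by
  obtain ⟨A, B, hAB, hA, hB, hA', hB'⟩ := exists_index_interval (t₀ := t₀) hu hv hq hpq hb
  have h := (hB'.sub hA').div_const 2
  rw [show ((p * u + q * v)⁻¹ - -(p * u + q * v)⁻¹) / 2 = (p * u + q * v)⁻¹ by ring] at h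
  refine h.congr' ?_
  filter_upwards [hA.eventually (eventually_le_atBot 0), hB.eventually (eventually_ge_atTop 0),
    eventually_gt_atTop 0] with R hA0 hB0 hR
  have hset : tilingPoints u v t₀ b ∩ Metric.closedBall 0 R =
      tilingPoint u v t₀ b '' (Finset.Ico (A R) (B R) : Finset ℤ) := by
    ext y
    simp only [tilingPoints, Set.mem_inter_iff, Set.mem_range, mem_closedBall_zero_iff,
      Real.norm_eq_abs, Set.mem_image, Finset.coe_Ico, Set.mem_Ico, ← hAB]
    constructor
    · rintro ⟨⟨n, rfl⟩, h⟩
      exact ⟨n, h, rfl⟩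
    · rintro ⟨n, h, rfl⟩
      exact ⟨⟨n, rfl⟩, h⟩
  rw [hset, Set.ncard_image_of_injective _ (strictMono_tilingPoint hu hv).injective,
    Set.ncard_coe_finset, Int.card_Ico, Real.volume_real_closedBall hR.le]
  have : (((B R - A R).toNat : ℕ) : ℝ) = B R - A R := by
    have : ((B R - A R).toNat : ℤ) = B R - A R := Int.toNat_of_nonneg (by omega)
    exact_mod_cast this
  rw [this]
  field_simp

end

/-! ### Convergence to the autocorrelation. -/

lemma isFiniteMeasure_sum_dirac (s : Finset ℤ) (a : ℤ → ℝ) :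
    IsFiniteMeasure (∑ i ∈ s, Measure.dirac (a i)) :=
  ⟨by simp [Measure.finsetSum_apply]⟩

lemma conv_sum_dirac (s t : Finset ℤ) (a b : ℤ → ℝ) :
    Measure.conv (∑ i ∈ s, Measure.dirac (a i)) (∑ j ∈ t, Measure.dirac (b j)) =
      ∑ i ∈ s, ∑ j ∈ t, Measure.dirac (a i + b j) := by
  have := isFiniteMeasure_sum_dirac t b
  refine Measure.ext_of_lintegral _ fun f hf => ?_
  rw [Measure.lintegral_conv hf]
  simp [lintegral_finsetSum_measure]

section
variable {u v t₀ : ℝ} {b : ℤ → Bool}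

lemma diracComb_tilingPoints (hu : 0 < u) (hv : 0 < v) : diracComb (tilingPoints u v t₀ b) =
    Measure.sum fun n : ℤ => Measure.dirac (tilingPoint u v t₀ b n) := by
  have hinj : Function.Injective (tilingPoint u v t₀ b) := (strictMono_tilingPoint hu hv).injective
  refine Measure.ext fun s hs => ?_
  rw [diracComb, Measure.sum_apply _ hs, Measure.sum_apply _ hs]
  exact ((Equiv.ofInjective _ hinj).tsum_eq
    (fun y : Set.range (tilingPoint u v t₀ b) => Measure.dirac (y : ℝ) s)).symm

lemma restrict_diracComb_tilingPoints (hu : 0 < u) (hv : 0 < v) {R : ℝ} {A B : ℤ}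
    (h : ∀ n, |tilingPoint u v t₀ b n| ≤ R ↔ A ≤ n ∧ n < B) :
    (diracComb (tilingPoints u v t₀ b)).restrict (Metric.closedBall 0 R) =
      ∑ n ∈ Finset.Ico A B, Measure.dirac (tilingPoint u v t₀ b n) := by
  classical
  rw [diracComb_tilingPoints hu hv, Measure.restrict_sum _ Metric.isClosed_closedBall.measurableSet]
  refine Measure.ext fun s hs => ?_
  rw [Measure.sum_apply _ hs, Measure.finsetSum_apply, tsum_eq_sum (s := Finset.Ico A B)]
  · refine Finset.sum_congr rfl fun n hn => ?_
    rw [restrict_dirac, if_pos]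
    rw [mem_closedBall_zero_iff, Real.norm_eq_abs, h]
    exact Finset.mem_Ico.1 hn
  · intro n hn
    rw [restrict_dirac, if_neg]
    · rfl
    · rw [mem_closedBall_zero_iff, Real.norm_eq_abs, h]
      exact fun h => hn (Finset.mem_Ico.2 h)

lemma integral_autocorrelationApprox (hu : 0 < u) (hv : 0 < v) {R : ℝ} (hR : 0 < R) {A B : ℤ}
    (h : ∀ n, |tilingPoint u v t₀ b n| ≤ R ↔ A ≤ n ∧ n < B) (f : ℝ → ℂ) :
    ∫ y, f y ∂autocorrelationApprox (diracComb (tilingPoints u v t₀ b)) R =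
      (2 * R)⁻¹ • ∑ j ∈ Finset.Ico A B, ∑ i ∈ Finset.Ico A B,
        f (tilingPoint u v t₀ b i - tilingPoint u v t₀ b j) := by
  have hmap : (∑ n ∈ Finset.Ico A B, Measure.dirac (tilingPoint u v t₀ b n)).map (fun x => -x) =
      ∑ n ∈ Finset.Ico A B, Measure.dirac (-tilingPoint u v t₀ b n) := by
    refine Measure.ext_of_lintegral _ fun g hg => ?_
    rw [lintegral_map hg measurable_neg]
    simp [lintegral_finsetSum_measure]
  rw [autocorrelationApprox, restrict_diracComb_tilingPoints hu hv h, hmap, conv_sum_dirac,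
    integral_smul_measure, ENNReal.toReal_inv, Real.volume_closedBall,
    ENNReal.toReal_ofReal (by positivity)]
  congr 1
  rw [integral_finsetSum_measure fun i _ => (integrable_finsetSum_measure.2 fun j _ =>
      integrable_dirac (by simp)), Finset.sum_comm]
  refine Finset.sum_congr rfl fun i _ => ?_
  rw [integral_finsetSum_measure fun j _ => integrable_dirac (by simp)]
  refine Finset.sum_congr rfl fun j _ => ?_
  rw [integral_dirac, sub_eq_add_neg]

end

section
variable {u v p q t₀ : ℝ} (hu : 0 < u) (hv : 0 < v) (hq : q = 1 - p) (hpq : 0 < p * q)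
  {b : ℤ → Bool} (hb : HasWordFrequencies p q b)

/-- Double sums over an index interval reduce, up to a bounded error, to sums along diagonals. -/
lemma norm_sum_sub_sum_le (F : ℤ → ℤ → ℂ) {C : ℝ} (hC : ∀ i j, ‖F i j‖ ≤ C) {M : ℕ}
    (hM : ∀ i j, (M : ℤ) < |i - j| → F i j = 0) (A B : ℤ) :
    ‖(∑ j ∈ Finset.Ico A B, ∑ i ∈ Finset.Ico A B, F i j) -
      ∑ n ∈ Finset.Icc (-M : ℤ) M, ∑ j ∈ Finset.Ico A B, F (j + n) j‖ ≤ 2 * M * ((2 * M + 1) * C) := by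
  have hC0 : 0 ≤ C := (norm_nonneg _).trans (hC 0 0)
  have hre : ∀ j, ∑ n ∈ Finset.Icc (-M : ℤ) M, F (j + n) j =
      ∑ i ∈ Finset.Icc (j - M) (j + M), F i j := fun j => by
    refine Finset.sum_bij (fun n _ => j + n) ?_ ?_ ?_ ?_
    · intro n hn; simp only [Finset.mem_Icc] at hn ⊢; omega
    · intro n _ n' _ h; simpa using h
    · intro i hi
      refine ⟨i - j, ?_, by ring⟩
      simp only [Finset.mem_Icc] at hi ⊢; omega
    · intro n _; rfl
  have hin : ∀ j, ∑ i ∈ Finset.Ico A B, F i j =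
      ∑ i ∈ Finset.Icc (j - M) (j + M) ∩ Finset.Ico A B, F i j := fun j => by
    refine (Finset.sum_subset Finset.inter_subset_right fun i hi hi' => hM i j ?_).symm
    rw [Finset.mem_inter, Finset.mem_Icc] at hi'
    by_contra h
    rw [not_lt, abs_le] at h
    exact hi' ⟨by omega, hi⟩
  have hdiff : ∀ j, ∑ i ∈ Finset.Ico A B, F i j - ∑ i ∈ Finset.Icc (j - M) (j + M), F i j =
      -∑ i ∈ Finset.Icc (j - M) (j + M) \ Finset.Ico A B, F i j := fun j => by
    rw [hin, ← Finset.sum_inter_add_sum_sdiff (Finset.Icc (j - M) (j + M)) (Finset.Ico A B)]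
    ring
  rw [Finset.sum_comm (s := Finset.Icc (-M : ℤ) M)]
  simp_rw [hre]
  rw [← Finset.sum_sub_distrib]
  simp_rw [hdiff]
  -- Only rows within `M` of an end of the interval have a diagonal window sticking out of it. There
  -- are at most `2M` of them, each with error at most `(2M + 1)C`.
  set E := Finset.Ico A (A + M) ∪ Finset.Ico (B - M) B with hE
  have hout : ∀ j ∈ Finset.Ico A B, j ∉ E →
      -∑ i ∈ Finset.Icc (j - M) (j + M) \ Finset.Ico A B, F i j = 0 := by
    intro j hj hjE
    rw [Finset.sdiff_eq_empty_iff_subset.2, Finset.sum_empty, neg_zero]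
    intro i hi
    simp only [hE, Finset.mem_union, Finset.mem_Ico, Finset.mem_Icc] at *
    omega
  have hbd : ∀ j : ℤ, ‖-∑ i ∈ Finset.Icc (j - M) (j + M) \ Finset.Ico A B, F i j‖ ≤ (2 * M + 1) * C := by
    intro j
    rw [norm_neg]
    refine (norm_sum_le_of_le _ fun i _ => hC i j).trans ?_
    rw [Finset.sum_const, nsmul_eq_mul]
    gcongr
    have h1 : (Finset.Icc (j - M) (j + M) \ Finset.Ico A B).card ≤ (Finset.Icc (j - M) (j + M)).card :=
      Finset.card_le_card Finset.sdiff_subset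
    rw [Int.card_Icc] at h1
    have h2 : (Finset.Icc (j - (M : ℤ)) (j + M) \ Finset.Ico A B).card ≤ 2 * M + 1 := by omega
    exact_mod_cast h2
  have hcard : (E.card : ℝ) ≤ 2 * M := by
    have h1 : E.card ≤ _ := Finset.card_union_le (Finset.Ico A (A + M)) (Finset.Ico (B - M) B)
    rw [Int.card_Ico, Int.card_Ico] at h1
    have h2 : E.card ≤ 2 * M := by omega
    exact_mod_cast h2
  calc _ = ‖∑ j ∈ Finset.Ico A B ∩ E,
        -∑ i ∈ Finset.Icc (j - M) (j + M) \ Finset.Ico A B, F i j‖ := by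
        congr 1
        refine (Finset.sum_subset Finset.inter_subset_left fun j hj hj' => hout j hj fun h => ?_).symm
        exact hj' (Finset.mem_inter.2 ⟨hj, h⟩)
    _ ≤ (Finset.Ico A B ∩ E).card • ((2 * M + 1) * C) :=
        (norm_sum_le_of_le _ fun j _ => hbd j).trans_eq (by rw [Finset.sum_const])
    _ ≤ 2 * M * ((2 * M + 1) * C) := by
        rw [nsmul_eq_mul]
        gcongr
        exact le_trans (by exact_mod_cast Finset.card_le_card Finset.inter_subset_right) hcard

include hb

/-- Sums of a function of the word at position `j + s`, over a growing interval of `j`. -/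
lemma tendsto_sum_word {n : ℕ} (G : (Fin n → Bool) → ℂ) (s : ℤ) {A B : ℝ → ℤ} {m : ℝ}
    (hA : Tendsto A atTop atBot) (hB : Tendsto B atTop atTop)
    (hA' : Tendsto (fun R => (A R : ℝ) / R) atTop (𝓝 (-m)))
    (hB' : Tendsto (fun R => (B R : ℝ) / R) atTop (𝓝 m)) :
    Tendsto (fun R : ℝ => (2 * R)⁻¹ • ∑ j ∈ Finset.Ico (A R) (B R), G fun i => b (j + s + i)) atTop
      (𝓝 (m • ∑ w, wordWeight p q w • G w)) := by
  -- The fixed shift `s` is harmless because `s / R → 0`.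
  have key : ∀ (N : ℝ → ℤ) (c : ℝ) (w : Fin n → Bool), Tendsto (fun R => (N R : ℝ) / R) atTop (𝓝 c) →
      Tendsto (fun R => leftEndpoint 0 (wordIndicator b w) (N R + s) / (N R + s : ℤ)) atTop
        (𝓝 (wordWeight p q w)) → (∀ᶠ R in atTop, ((N R + s : ℤ) : ℝ) ≠ 0) →
      Tendsto (fun R => leftEndpoint 0 (wordIndicator b w) (N R + s) / R) atTop
        (𝓝 (wordWeight p q w * c)) := by
    intro N c w h1 h2 h3
    have h4 : Tendsto (fun R : ℝ => (s : ℝ) / R) atTop (𝓝 0) := tendsto_const_nhds.div_atTop tendsto_id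
    have h5 := h2.mul (h1.add h4)
    rw [add_zero] at h5
    refine h5.congr' ?_
    filter_upwards [h3] with R hR
    rw [← add_div, ← Int.cast_add, div_mul_div_cancel₀ hR]
  have hAs : Tendsto (fun R => A R + s) atTop atBot := tendsto_atBot_add_const_right _ _ hA
  have hBs : Tendsto (fun R => B R + s) atTop atTop := tendsto_atTop_add_const_right _ _ hB
  have hw : ∀ w : Fin n → Bool, Tendsto (fun R => (leftEndpoint 0 (wordIndicator b w) (B R + s) / R -
      leftEndpoint 0 (wordIndicator b w) (A R + s) / R) / 2) atTop (𝓝 (m * wordWeight p q w)) := by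
    intro w
    have a1 := key B m w hB' ((hb n w).1.comp hBs)
      ((hBs.eventually (eventually_gt_atTop 0)).mono fun R h => by exact_mod_cast h.ne')
    have a2 := key A (-m) w hA' ((hb n w).2.comp hAs)
      ((hAs.eventually (eventually_lt_atBot 0)).mono fun R h => by exact_mod_cast h.ne)
    have a3 := (a1.sub a2).div_const 2
    rwa [show (wordWeight p q w * m - wordWeight p q w * -m) / 2 = m * wordWeight p q w by ring] at a3
  have hsum := tendsto_finsetSum Finset.univ fun w _ => (hw w).smul_const (G w)
  rw [Finset.smul_sum]
  simp_rw [smul_smul]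
  refine hsum.congr' ?_
  filter_upwards [hA.eventually (eventually_le_atBot 0), hB.eventually (eventually_ge_atTop 0),
    eventually_gt_atTop 0] with R hA0 hB0 hR
  have e1 : ∑ j ∈ Finset.Ico (A R) (B R), (G fun i => b (j + s + i)) =
      ∑ j ∈ Finset.Ico (A R + s) (B R + s), G fun i => b (j + i) := by
    rw [← Finset.sum_image (s := Finset.Ico (A R) (B R)) (g := fun j => j + s)
      (f := fun j => G fun i => b (j + i)) (by intro a _ c _ h; simpa using h),
      Finset.image_add_right_Ico]
  rw [e1]
  simp_rw [← sum_wordIndicator_smul G]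
  rw [Finset.sum_comm, Finset.smul_sum]
  refine Finset.sum_congr rfl fun w _ => ?_
  rw [← Finset.sum_smul, sum_Ico_eq_leftEndpoint_sub 0 _ (by omega), smul_smul]
  congr 1
  field_simp

include hu hv hq hpq

/-- A compactly supported `f` sees only index differences up to some `M`. The double sum is thus, up
to a bounded error killed by `1 / (2R)`, a finite sum of diagonals, and along each one the word
frequencies give the average over the displacement law. -/
theorem isNaturalAutocorrelation_tiling {d : ℝ} (hd : d = (p * u + q * v)⁻¹) :
    IsNaturalAutocorrelation (diracComb (tilingPoints u v t₀ b)) (tilingAutocorrelation u v p q d) := by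
  obtain ⟨hp0, hq0⟩ := pos_of_mul_pos hq hpq
  have hdpos : 0 < d := by rw [hd]; positivity
  have hc : 0 < min u v := lt_min hu hv
  have hlf := isLocallyFiniteMeasure_of_integrable
    (integrable_tilingAutocorrelation (d := d) hu hv hq hpq)
  refine ⟨hlf, fun f hf hfs => ?_⟩
  obtain ⟨A, B, hAB, hA, hB, hA', hB'⟩ := exists_index_interval (t₀ := t₀) hu hv hq hpq hb
  rw [← hd] at hA' hB'
  obtain ⟨C, hC⟩ := hfs.exists_bound_of_continuous hf
  obtain ⟨K, hK⟩ : ∃ K : ℝ, ∀ x, K < |x| → f x = 0 := by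
    obtain ⟨K, hK⟩ := hfs.isCompact.isBounded.subset_closedBall 0
    refine ⟨K, fun x hx => image_eq_zero_of_notMem_tsupport fun h => ?_⟩
    have := hK h
    rw [mem_closedBall_zero_iff, Real.norm_eq_abs] at this
    linarith
  obtain ⟨M, hM⟩ := exists_nat_gt (K / min u v)
  rw [div_lt_iff₀ hc] at hM
  set x := tilingPoint u v t₀ b with hx
  have hfar : ∀ y (n : ℤ), (M : ℤ) < |n| → |(n : ℝ)| * min u v ≤ |y| → f y = 0 := by
    intro y n hn hy
    refine hK y (hM.trans_le (le_trans ?_ hy))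
    gcongr
    exact_mod_cast hn.le
  have hdiag : ∀ n : ℤ, Tendsto (fun R : ℝ => (2 * R)⁻¹ • ∑ j ∈ Finset.Ico (A R) (B R), f (x (j + n) - x j))
      atTop (𝓝 (d • ∫ y, f y ∂displacementLaw u v p q n)) := by
    intro n
    rw [integral_displacementLaw hp0.le hq0.le]
    -- The tiles between points `j` and `j + n` start at index `j` if `n ≥ 0` and at `j + n` if `n <
    -- 0`; hence the shift `min n 0`.
    have t := tendsto_sum_word hb
      (fun w : Fin n.natAbs → Bool => f ((n.sign : ℝ) * wordLength u v w)) (min n 0) hA hB hA' hB'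
    refine t.congr fun R => ?_
    congr 1
    refine Finset.sum_congr rfl fun j _ => ?_
    congr 1
    rcases lt_trichotomy n 0 with hn | hn | hn
    · have e := tilingPoint_add_natCast (u := u) (v := v) (t₀ := t₀) (b := b) (j + n) n.natAbs
      rw [show j + n + (n.natAbs : ℤ) = j by omega, ← hx] at e
      rw [min_eq_left hn.le, Int.sign_eq_neg_one_of_neg hn]
      push_cast
      linarith
    · subst hn
      simp
    · have e := tilingPoint_add_natCast (u := u) (v := v) (t₀ := t₀) (b := b) j n.natAbs
      rw [show j + (n.natAbs : ℤ) = j + n by omega, ← hx] at e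
      rw [min_eq_right hn.le, Int.sign_eq_one_of_pos hn, add_zero]
      push_cast
      linarith
  have hlim : ∫ y, f y ∂tilingAutocorrelation u v p q d =
      ∑ n ∈ Finset.Icc (-M : ℤ) M, d • ∫ y, f y ∂displacementLaw u v p q n := by
    have hint : Integrable f (Measure.sum fun n : ℤ => displacementLaw u v p q n) := by
      have := hf.integrable_of_hasCompactSupport (μ := tilingAutocorrelation u v p q d) hfs
      unfold tilingAutocorrelation at this
      rwa [integrable_smul_measure (by simpa using hdpos) ENNReal.ofReal_ne_top] at this
    rw [tilingAutocorrelation, integral_smul_measure, ENNReal.toReal_ofReal hdpos.le,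
      integral_sum_measure hint, tsum_eq_sum (s := Finset.Icc (-M : ℤ) M), Finset.smul_sum]
    intro n hn
    rw [integral_displacementLaw hp0.le hq0.le]
    refine Finset.sum_eq_zero fun w _ => ?_
    rw [hfar _ n, smul_zero]
    · by_contra h
      rw [not_lt, abs_le] at h
      exact hn (Finset.mem_Icc.2 h)
    · have := natAbs_mul_le_abs (min_le_left u v) (min_le_right u v) n w
      rwa [Nat.cast_natAbs, Int.cast_abs] at this
  rw [hlim]
  have hmain := tendsto_finsetSum (Finset.Icc (-M : ℤ) M) fun n _ => hdiag n
  have herr : Tendsto (fun R : ℝ => (2 * R)⁻¹ •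
      ((∑ j ∈ Finset.Ico (A R) (B R), ∑ i ∈ Finset.Ico (A R) (B R), f (x i - x j)) -
        ∑ n ∈ Finset.Icc (-M : ℤ) M, ∑ j ∈ Finset.Ico (A R) (B R), f (x (j + n) - x j)))
      atTop (𝓝 0) := by
    have h0 : Tendsto (fun R : ℝ => (2 * R)⁻¹ * (2 * M * ((2 * M + 1) * C))) atTop (𝓝 0) := by
      have : Tendsto (fun R : ℝ => (2 * R)⁻¹) atTop (𝓝 0) :=
        tendsto_inv_atTop_zero.comp (tendsto_id.const_mul_atTop two_pos)
      simpa using this.mul_const (2 * M * ((2 * M + 1) * C))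
    refine squeeze_zero_norm' ?_ h0
    filter_upwards [eventually_gt_atTop 0] with R hR
    rw [norm_smul, Real.norm_of_nonneg (by positivity)]
    refine mul_le_mul_of_nonneg_left ?_ (by positivity)
    refine norm_sum_sub_sum_le (fun i j => f (x i - x j)) (fun i j => hC _) (fun i j hij => ?_) _ _
    refine hfar _ (i - j) hij ?_
    push_cast
    exact abs_sub_mul_min_le i j
  have := hmain.add herr
  rw [add_zero] at this
  refine this.congr' ?_
  filter_upwards [eventually_gt_atTop 0] with R hR
  rw [integral_autocorrelationApprox hu hv hR (hAB R), smul_sub, ← Finset.smul_sum]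
  abel

end

end RandomTiling

end

/-! ### The theorem. -/

theorem mainTheorem1 {Ω : Type*} [MeasurableSpace Ω] (P : Measure Ω) [IsProbabilityMeasure P]
    (u v p q d : ℝ) (hu : 0 < u) (hv : 0 < v) (hq : q = 1 - p) (hpq : 0 < p * q)
    (hd : d = (p * u + q * v)⁻¹)
    -- the i.i.d. letters of the tiling: `true` (length `u`) with probability `p`,
    -- `false` (length `v`) with probability `q`
    (X : ℤ → Ω → Bool) (hXm : ∀ i, Measurable (X i)) (hXi : iIndepFun X P)
    (hXp : ∀ i, P {σ | X i σ = true} = ENNReal.ofReal p) :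
    ∃ g : ℝ → ℝ,
      -- `g` is the smooth continuation of the explicit quotient
      ContDiff ℝ ∞ g ∧ (∀ k, 0 ≤ g k) ∧
      (∀ k, ¬ RandomTiling.IsInteger (k * (u - v)) →
        RandomTiling.denom u v p q k ≠ 0 ∧
        g k = d * (p * q) * Real.sin (Real.pi * k * (u - v)) ^ 2 /
          RandomTiling.denom u v p q k) ∧
      -- its values at the exceptional points
      (Irrational (u / v) →
        (∀ k, RandomTiling.IsInteger (k * (u - v)) → k ≠ 0 → g k = 0) ∧
        g 0 = d * (p * q) * (u - v) ^ 2 / (p * u ^ 2 + q * v ^ 2 - p * q * (u - v) ^ 2) ∧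
        g 0 = d * (p * q * (u - v) ^ 2 / (p * u + q * v) ^ 2)) ∧
      (∀ a b : ℤ, IsCoprime a b → u / v = a / b →
        ∀ k, RandomTiling.IsInteger (k * (u - v)) →
          (RandomTiling.IsInteger (k * u) ↔ RandomTiling.IsInteger (k * v)) ∧
          (¬ RandomTiling.IsInteger (k * u) → g k = 0) ∧
          (RandomTiling.IsInteger (k * u) →
            g k = d * (p * q * ((a : ℝ) - b) ^ 2 / (p * a + q * b) ^ 2))) ∧
      -- almost surely, wherever the origin is placed
      ∀ᵐ σ ∂P, ∀ t₀ : ℝ,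
        RandomTiling.HasNaturalDensity (RandomTiling.tilingPoints u v t₀ fun i => X i σ) d ∧
        ∃ γ γhat : Measure ℝ,
          RandomTiling.IsNaturalAutocorrelation
            (RandomTiling.diracComb (RandomTiling.tilingPoints u v t₀ fun i => X i σ)) γ ∧
          RandomTiling.IsFourierTransform γ γhat ∧
          γhat = RandomTiling.purePointPart γhat + RandomTiling.acPart γhat ∧
          (Irrational (u / v) →
            RandomTiling.purePointPart γhat = ENNReal.ofReal (d ^ 2) • Measure.dirac 0) ∧
          (∀ a b : ℤ, IsCoprime a b → u / v = a / b →
            ∀ ξ : ℝ, ξ = u / a →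
              ξ = v / b ∧
              RandomTiling.purePointPart γhat = ENNReal.ofReal (d ^ 2) •
                RandomTiling.diracComb (Set.range fun m : ℤ => 1 / ξ * (m : ℝ))) ∧
          RandomTiling.acPart γhat = volume.withDensity fun k => ENNReal.ofReal (g k) := by
  obtain ⟨hp0, hq0⟩ := RandomTiling.pos_of_mul_pos hq hpq
  have hm : 0 < p * u + q * v := by positivity
  have hdpos : 0 < d := by rw [hd]; positivity
  have hm2 : p * u ^ 2 + q * v ^ 2 - p * q * (u - v) ^ 2 = (p * u + q * v) ^ 2 := by
    rw [hq]; ring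
  refine ⟨RandomTiling.acDensity u v p q d, RandomTiling.contDiff_acDensity u v p q d hu hv hq hpq,
    fun k => RandomTiling.acDensity_nonneg u v p q d k hdpos.le hq hpq, fun k hk => ?_,
    fun hirr => ?_, fun a b hab huv k hk => ?_, ?_⟩
  · have hkr : k ∉ RandomTiling.resonances u v := fun h => hk (by
      rw [mul_sub]; exact h.1.sub h.2)
    exact ⟨fun h => hkr ((RandomTiling.denom_eq_zero_iff u v p q k hq hpq).1 h),
      by rw [RandomTiling.acDensity, if_neg hkr]⟩
  · have h0 : RandomTiling.acDensity u v p q d 0 =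
        d * (p * q) * (u - v) ^ 2 / (p * u + q * v) ^ 2 := by
      rw [RandomTiling.acDensity, if_pos (RandomTiling.zero_mem_resonances u v)]
    refine ⟨fun k hk hk0 => RandomTiling.acDensity_eq_zero p q d ?_ hk, ?_, ?_⟩
    · rw [RandomTiling.resonances_eq_of_irrational hirr]
      exact hk0
    · rw [h0, hm2]
    · rw [h0]; ring
  · have hiff : RandomTiling.IsInteger (k * u) ↔ RandomTiling.IsInteger (k * v) := by
      rw [mul_sub] at hk
      constructor
      · intro h
        have := h.sub hk
        rwa [sub_sub_cancel] at this
      · intro h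
        have := hk.add h
        rwa [sub_add_cancel] at this
    refine ⟨hiff, fun h => RandomTiling.acDensity_eq_zero p q d (fun hr => h hr.1) hk, fun h => ?_⟩
    rw [RandomTiling.acDensity, if_pos ⟨h, hiff.1 h⟩]
    have hb0 : (b : ℝ) ≠ 0 := by
      intro hb
      have : 0 < u / v := by positivity
      rw [huv, hb] at this
      simp at this
    -- Writing `u = ξa` and `v = ξb`, the factor `ξ²` cancels from the value of the density at a
    -- resonance.
    have hua : u = v / b * a := by
      rw [div_eq_div_iff hv.ne' hb0] at huv
      field_simp
      linarith
    have hvb : v = v / b * b := by field_simp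
    have hξ : v / b ≠ 0 := div_ne_zero hv.ne' hb0
    set ξ := v / b with hξd
    have e1 : p * u + q * v = ξ * (p * a + q * b) := by rw [hua, hvb]; ring
    have e2 : u - v = ξ * (a - b) := by rw [hua, hvb]; ring
    have e3 : p * a + q * b ≠ 0 := fun h0 => hm.ne' (by rw [e1, h0, mul_zero])
    rw [e1, e2]
    field_simp
  -- Word frequencies do not involve `t₀`, so a single null set serves all translates, with the same
  -- two measures throughout.
  · filter_upwards [RandomTiling.ae_hasWordFrequencies hp0.le hq0.le hq hXm hXi hXp] with σ hσ t₀
    refine ⟨hd ▸ RandomTiling.hasNaturalDensity_tilingPoints hu hv hq hpq hσ,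
      RandomTiling.tilingAutocorrelation u v p q d, RandomTiling.tilingDiffraction u v p q d,
      RandomTiling.isNaturalAutocorrelation_tiling hu hv hq hpq hσ hd,
      RandomTiling.isFourierTransform_tiling hu hv hq hpq hd, ?_, fun hirr => ?_,
      fun a b hab huv ξ hξ => ?_, RandomTiling.acPart_tilingDiffraction hu hv hq hpq⟩
    · rw [RandomTiling.purePointPart_tilingDiffraction hu hv hq hpq hd,
        RandomTiling.acPart_tilingDiffraction hu hv hq hpq, RandomTiling.tilingDiffraction]
    · rw [RandomTiling.purePointPart_tilingDiffraction hu hv hq hpq hd,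
        RandomTiling.resonances_eq_of_irrational hirr]
      congr 1
      have : Unique ({0} : Set ℝ) := Set.uniqueSingleton 0
      refine MeasureTheory.Measure.ext fun s hs => ?_
      rw [RandomTiling.diracComb, MeasureTheory.Measure.sum_apply _ hs, tsum_fintype]
      simp [Set.mem_singleton_iff.1 (default : ({0} : Set ℝ)).2]
    · obtain ⟨h1, h2⟩ := RandomTiling.resonances_eq_of_rational hu hv hab huv
      subst hξ
      exact ⟨h1, by rw [RandomTiling.purePointPart_tilingDiffraction hu hv hq hpq hd, h2]⟩
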